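/- Consider the free massless spin-3/2 field (gravitino) in $n=4$ spacetime dimensions in the antifield formalism. Let $K$ be a field of characteristic zero (for instance $\mathbb R$ or $\mathbb C$). The algebra of local forms $\mathcal A$ is the free graded-commutative $K$-algebra generated by the differentials $dx^\mu$ ($\mu=0,\dots,3$) and by all derivatives $\partial_{\mu_1\cdots\mu_r}$, $r\ge 0$ (symmetric in their indices), of the components of the four-component (Majorana) spinors $\psi_\mu$ (the gravitino), $C$ (the ghost), $\psi^{*\mu}$ and $C^*$ (the antifields). Here $dx^\mu,\psi_\mu,C^*$ are odd and $C,\psi^{*\mu}$ are even. Thus local forms depend polynomially on the fields and on finitely many of their derivatives, without explicit dependence on $x$. The form degree counts the $dx^\mu$; the antighost number (antifield number) is $1$ for $\psi^{*\mu}$, $2$ for $C^*$ and $0$ for the other generators; the pure ghost number is $1$ for $C$ and $0$ for the other generators; derivatives do not change these degrees. Let $d=dx^\mu\partial_\mu$, where $\partial_\mu$ is the total derivative, and let $\gamma$ be the odd derivation with $\gamma\psi_\mu=\partial_\mu C$ and $\gamma C=\gamma\psi^{*\mu}=\gamma C^*=\gamma\, dx^\mu=0$ that commutes with every $\partial_\mu$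 (so that $\gamma d+d\gamma=0$). An invariant polynomial is an element of the subalgebra of $\mathcal A$ generated by the $dx^\mu$ and all derivatives of $\psi_{\mu\alpha}=\partial_{[\alpha}\psi_{\mu]}$, $\psi^{*\mu}$ and $C^*$. (1) Let $a$ be an invariant polynomial of form degree $p<4$ and antighost number $k>0$. If $da=0$, then $a=db$ for some invariant polynomial $b$ of form degree $p-1$ and antighost number $k$. (2) Let $a$ be a local form of form degree $p$, antighost number $k>0$ and pure ghost number $g$. There is a local form $b$ with $\gamma a+db=0$ if and only if there is a local form $c$ of form degree $p-1$, antighost number $k$ and pure ghost number $g$ such that $a'=a+dc$ satisfies $\gamma a'=0$. (The only form of form degree $-1$ is $0$; so for $p=0$, (1) says that $a=0$, and (2) says that $\gamma a=0$.) -/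

import Mathlib

/-!
Local forms of the free massless spin-3/2 field (gravitino) in four spacetime dimensions, in the
antifield formalism: the free graded-commutative algebra on the differentials `dx^μ` and on the jet
coordinates of the gravitino `ψ_μ`, its ghost `C` and the antifields `ψ*^μ`, `C*`.  All Majorana
spinors have four components.  There is no explicit dependence on the coordinates `x^μ`.
-/

namespace Gravitino

/-- A multi-index `I = (I_0, I_1, I_2, I_3)`, encoding the iterated derivative
`∂_0^{I_0} ∂_1^{I_1} ∂_2^{I_2} ∂_3^{I_3}`. -/
abbrev MultiIndex : Type := Fin 4 → ℕ

/-- The generators: `dx^μ`, and all derivatives `∂_I` of the components of the fields. The first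
argument of `psi`, `psiStar` is the vector index `μ`, and `A` is the spinor index. -/
inductive Gen : Type
  | dx (μ : Fin 4) : Gen
  | psi (μ A : Fin 4) (I : MultiIndex) : Gen
  | ghost (A : Fin 4) (I : MultiIndex) : Gen
  | psiStar (μ A : Fin 4) (I : MultiIndex) : Gen
  | ghostStar (A : Fin 4) (I : MultiIndex) : Gen

namespace Gen

/-- Grassmann parity (`0` is even, `1` is odd): `dx^μ`, `ψ_μ` and `C*` are odd, `C` and `ψ*^μ` are
even. -/
def parity : Gen → ℕ
  | dx _ => 1
  | psi _ _ _ => 1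
  | ghost _ _ => 0
  | psiStar _ _ _ => 0
  | ghostStar _ _ => 1

/-- Form degree. -/
def formDeg : Gen → ℤ
  | dx _ => 1
  | psi _ _ _ => 0
  | ghost _ _ => 0
  | psiStar _ _ _ => 0
  | ghostStar _ _ => 0

/-- Antighost (antifield) number. -/
def antigh : Gen → ℤ
  | dx _ => 0
  | psi _ _ _ => 0
  | ghost _ _ => 0
  | psiStar _ _ _ => 1
  | ghostStar _ _ => 2

/-- Pure ghost number. -/
def puregh : Gen → ℤ
  | dx _ => 0
  | psi _ _ _ => 0
  | ghost _ _ => 1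
  | psiStar _ _ _ => 0
  | ghostStar _ _ => 0

theorem parity_cases (x : Gen) : x.parity = 0 ∨ x.parity = 1 := by
  cases x <;> simp [parity]

end Gen

section Algebra

variable (K : Type*) [Field K]

/-- The graded commutation relations `x y = (-1)^{|x||y|} y x` between generators. (If `2` is
invertible in `K` they include `x² = 0` for odd `x`.) -/
inductive Rel : FreeAlgebra K Gen → FreeAlgebra K Gen → Prop
  | comm (x y : Gen) : Rel (FreeAlgebra.ι K x * FreeAlgebra.ι K y)
      ((-1 : K) ^ (x.parity * y.parity) • (FreeAlgebra.ι K y * FreeAlgebra.ι K x))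

/-- The algebra of local forms: the free graded-commutative `K`-algebra on the generators, i.e.
differential forms whose coefficients are polynomials in the fields, the ghosts, the antifields and
finitely many of their derivatives. -/
def LocalForm : Type _ := RingQuot (Rel K)

noncomputable instance instRingLocalForm : Ring (LocalForm K) := inferInstanceAs (Ring (RingQuot (Rel K)))

noncomputable instance instAlgebraLocalForm : Algebra K (LocalForm K) :=
  inferInstanceAs (Algebra K (RingQuot (Rel K)))

/-- The quotient map from the free algebra. -/
noncomputable def mk : FreeAlgebra K Gen →ₐ[K] LocalForm K :=
  RingQuot.mkAlgHom K (Rel K)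

variable {K}

/-- A generator, as a local form. -/
noncomputable def gen (x : Gen) : LocalForm K :=
  mk K (FreeAlgebra.ι K x)

theorem gen_mul_gen (x y : Gen) :
    (gen x * gen y : LocalForm K) = (-1 : K) ^ (x.parity * y.parity) • (gen y * gen x) := by
  have h : mk K _ = mk K _ := RingQuot.mkAlgHom_rel K (Rel.comm (K := K) x y)
  rwa [map_mul, map_smul, map_mul] at h

/-- Universal property of the algebra of local forms. -/
noncomputable def lift {B : Type*} [Ring B] [Algebra K B] (f : Gen → B)
    (hf : ∀ x y, f x * f y = (-1 : K) ^ (x.parity * y.parity) • (f y * f x)) :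
    LocalForm K →ₐ[K] B :=
  RingQuot.liftAlgHom K (s := Rel K) ⟨FreeAlgebra.lift K f, by
    rintro _ _ ⟨x, y⟩
    simpa using hf x y⟩

theorem lift_gen {B : Type*} [Ring B] [Algebra K B] (f : Gen → B)
    (hf : ∀ x y, f x * f y = (-1 : K) ^ (x.parity * y.parity) • (f y * f x)) (x : Gen) :
    lift f hf (gen x) = f x :=
  (RingQuot.liftAlgHom_mkAlgHom_apply K _ _ _).trans (FreeAlgebra.lift_ι_apply f x)

/-- Local forms are generated by the generators. -/
theorem induction_on {P : LocalForm K → Prop} (a : LocalForm K)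
    (hc : ∀ r : K, P (algebraMap K _ r)) (hg : ∀ x, P (gen x))
    (hm : ∀ a b, P a → P b → P (a * b)) (ha : ∀ a b, P a → P b → P (a + b)) : P a := by
  obtain ⟨a, rfl⟩ : ∃ b, mk K b = a := RingQuot.mkAlgHom_surjective K (Rel K) a
  induction a using FreeAlgebra.induction with
  | grade0 r => rw [AlgHom.commutes]; exact hc r
  | grade1 x => exact hg x
  | mul a b h1 h2 => rw [map_mul]; exact hm _ _ h1 h2
  | add a b h1 h2 => rw [map_add]; exact ha _ _ h1 h2

theorem hom_ext {B : Type*} [Ring B] [Algebra K B] {f g : LocalForm K →ₐ[K] B}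
    (h : ∀ x, f (gen x) = g (gen x)) : f = g := by
  ext a
  induction a using induction_on with
  | hc r => simp only [AlgHom.commutes]
  | hg x => exact h x
  | hm a b h1 h2 => rw [map_mul, map_mul, h1, h2]
  | ha a b h1 h2 => rw [map_add, map_add, h1, h2]

/-- The algebra endomorphism multiplying a form of parity `q` by `(-1)^{s q}`. -/
noncomputable def twist (s : ℕ) : LocalForm K →ₐ[K] LocalForm K :=
  lift (fun x => (-1 : K) ^ (s * x.parity) • gen x) (by
    intro x y
    simp only [smul_mul_assoc, mul_smul_comm]
    rw [gen_mul_gen x y]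
    simp only [smul_smul]
    congr 1
    ring)

theorem twist_gen (s : ℕ) (x : Gen) :
    twist s (gen x : LocalForm K) = (-1 : K) ^ (s * x.parity) • gen x :=
  lift_gen _ _ x

theorem twist_zero (a : LocalForm K) : twist 0 a = a := by
  have : twist 0 = AlgHom.id K (LocalForm K) := hom_ext fun x => by simp [twist_gen]
  rw [this]; rfl

theorem mul_gen (a : LocalForm K) (y : Gen) : a * gen y = gen y * twist y.parity a := by
  induction a using induction_on with
  | hc r => rw [AlgHom.commutes]; exact Algebra.commutes r _
  | hg x =>
    rw [gen_mul_gen, twist_gen, mul_smul_comm, Nat.mul_comm]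
  | hm a b h1 h2 => rw [mul_assoc, h2, ← mul_assoc, h1, mul_assoc, map_mul]
  | ha a b h1 h2 => rw [add_mul, h1, h2, map_add, mul_add]

/-- `v` assigns to each generator `x` a local form of parity `|x| + s`. -/
def HasParity (s : ℕ) (v : Gen → LocalForm K) : Prop :=
  ∀ x, twist 1 (v x) = (-1 : K) ^ (x.parity + s) • v x

/-- Auxiliary: `a ↦ [[(-1)^{s|a|} a, D a], [0, a]]`, for the derivation `D` of parity `s` with value
`v x` at each generator `x`. -/
noncomputable def derivAux (s : ℕ) (v : Gen → LocalForm K) (hv : HasParity s v) :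
    LocalForm K →ₐ[K] Matrix (Fin 2) (Fin 2) (LocalForm K) :=
  lift (fun x => !![(-1 : K) ^ (s * x.parity) • gen x, v x; 0, gen x]) (by
    have key : ∀ x y : Gen, v x * gen y =
        (-1 : K) ^ (y.parity * (x.parity + s)) • (gen y * v x) := by
      intro x y
      rw [mul_gen]
      rcases y.parity_cases with h | h
      · rw [h, twist_zero]; simp
      · rw [h, hv x, mul_smul_comm, one_mul]
    intro x y
    ext i j
    fin_cases i <;> fin_cases j <;>
      simp only [Matrix.mul_apply, Fin.sum_univ_two, Matrix.smul_apply, Matrix.of_apply,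
        Matrix.cons_val', Matrix.cons_val_zero, Matrix.cons_val_one, Matrix.cons_val_fin_one,
        Fin.zero_eta, Fin.mk_one, Fin.isValue, zero_mul, mul_zero, add_zero, zero_add, smul_zero]
    · simp only [smul_mul_assoc, mul_smul_comm]
      rw [gen_mul_gen x y]
      simp only [smul_smul]
      congr 1
      ring
    · rw [key x y, smul_add, key y x]
      simp only [smul_mul_assoc, smul_smul]
      rw [add_comm]
      congr 2
      · ring
      · rw [mul_add, ← pow_add, show x.parity * y.parity + (x.parity * y.parity + x.parity * s)
          = 2 * (x.parity * y.parity) + s * x.parity by ring, pow_add, pow_mul]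
        simp
    · exact gen_mul_gen x y)

/-- The graded left derivation of parity `s` with prescribed values on the generators. -/
noncomputable def deriv (s : ℕ) (v : Gen → LocalForm K) (hv : HasParity s v) :
    LocalForm K →ₗ[K] LocalForm K where
  toFun a := derivAux s v hv a 0 1
  map_add' a b := by simp
  map_smul' r a := by simp

theorem deriv_gen (s : ℕ) (v : Gen → LocalForm K) (hv : HasParity s v) (x : Gen) :
    deriv s v hv (gen x) = v x := by
  simp [deriv, derivAux, lift_gen]

theorem derivAux_entries (s : ℕ) (v : Gen → LocalForm K) (hv : HasParity s v) (a : LocalForm K) :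
    derivAux s v hv a 0 0 = twist s a ∧ derivAux s v hv a 1 0 = 0 ∧ derivAux s v hv a 1 1 = a := by
  induction a using induction_on with
  | hc r => simp [Matrix.algebraMap_matrix_apply]
  | hg x => simp [derivAux, lift_gen, twist_gen]
  | hm a b h1 h2 =>
    obtain ⟨p1, p2, p3⟩ := h1
    obtain ⟨q1, q2, q3⟩ := h2
    simp [Matrix.mul_apply, Fin.sum_univ_two, p1, p2, p3, q1, q2, q3]
  | ha a b h1 h2 =>
    obtain ⟨p1, p2, p3⟩ := h1
    obtain ⟨q1, q2, q3⟩ := h2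
    simp [p1, p2, p3, q1, q2, q3]

/-- The graded Leibniz rule. -/
theorem deriv_mul (s : ℕ) (v : Gen → LocalForm K) (hv : HasParity s v) (a b : LocalForm K) :
    deriv s v hv (a * b) = deriv s v hv a * b + twist s a * deriv s v hv b := by
  have h1 := (derivAux_entries s v hv a).1
  have h2 := (derivAux_entries s v hv b).2.2
  change derivAux s v hv (a * b) 0 1 = derivAux s v hv a 0 1 * b + twist s a * derivAux s v hv b 0 1
  rw [map_mul, Matrix.mul_apply, Fin.sum_univ_two, h1, h2, add_comm]

/-- Values of the total derivative `∂_μ` on the generators. -/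
noncomputable def partialVal (μ : Fin 4) : Gen → LocalForm K
  | .dx _ => 0
  | .psi ν A I => gen (.psi ν A (I + Pi.single μ 1))
  | .ghost A I => gen (.ghost A (I + Pi.single μ 1))
  | .psiStar ν A I => gen (.psiStar ν A (I + Pi.single μ 1))
  | .ghostStar A I => gen (.ghostStar A (I + Pi.single μ 1))

theorem partialVal_parity (μ : Fin 4) : HasParity 0 (partialVal (K := K) μ) := by
  intro x
  cases x <;> simp [partialVal, twist_gen, Gen.parity]

/-- The total derivative `∂_μ`, an even derivation. -/
noncomputable def totalDeriv (μ : Fin 4) : LocalForm K →ₗ[K] LocalForm K :=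
  deriv 0 (partialVal μ) (partialVal_parity μ)

/-- The exterior (horizontal) differential `d = dx^μ ∂_μ`. -/
noncomputable def d : LocalForm K →ₗ[K] LocalForm K :=
  ∑ μ : Fin 4, (LinearMap.mulLeft K (gen (.dx μ))).comp (totalDeriv μ)

/-- Values of `γ` on the generators: `γ (∂_I ψ_μ) = ∂_I ∂_μ C`, and `γ` vanishes on the others. -/
noncomputable def gammaVal : Gen → LocalForm K
  | .dx _ => 0
  | .psi μ A I => gen (.ghost A (I + Pi.single μ 1))
  | .ghost _ _ => 0
  | .psiStar _ _ _ => 0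
  | .ghostStar _ _ => 0

theorem gammaVal_parity : HasParity 1 (gammaVal (K := K)) := by
  intro x
  cases x <;> simp [gammaVal, twist_gen, Gen.parity]

/-- The longitudinal differential `γ`, an odd derivation. -/
noncomputable def gamma : LocalForm K →ₗ[K] LocalForm K :=
  deriv 1 gammaVal gammaVal_parity

variable (K)

/-- The local forms of form degree `p`, antighost number `k` and pure ghost number `g`. -/
noncomputable def homogeneous (p k g : ℤ) : Submodule K (LocalForm K) :=
  Submodule.span K {m | ∃ l : List Gen, m = (l.map gen).prod ∧ (l.map Gen.formDeg).sum = p ∧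
    (l.map Gen.antigh).sum = k ∧ (l.map Gen.puregh).sum = g}

variable {K}

/-- The derivative `∂_I` of the component `A` of the field strength
`ψ_{μα} = ∂_{[α} ψ_{μ]} = (∂_α ψ_μ - ∂_μ ψ_α) / 2`. -/
noncomputable def fieldStrength (μ α A : Fin 4) (I : MultiIndex) : LocalForm K :=
  (2⁻¹ : K) • (gen (.psi μ A (I + Pi.single α 1)) - gen (.psi α A (I + Pi.single μ 1)))

variable (K)

/-- The invariant polynomials: polynomials in `dx^μ` and in all derivatives of `∂_{[α} ψ_{μ]}`,
of `ψ*^μ` and of `C*`. -/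
noncomputable def invariantPolynomials : Subalgebra K (LocalForm K) :=
  Algebra.adjoin K
    ({m | ∃ μ, m = gen (.dx μ)} ∪ {m | ∃ μ α A I, m = fieldStrength μ α A I} ∪
      {m | ∃ μ A I, m = gen (.psiStar μ A I)} ∪ {m | ∃ A I, m = gen (.ghostStar A I)})

end Algebra

end Gravitino

/-! Part (1) rests on a contracting homotopy that acts on the antifields only. The derivation `tau
μ` strips one derivative `∂_μ` off an antifield, weighted so that `[tau μ, ∂_ν] = δ_{μν} N`, with
`N` the antighost number. For `h = ∑ tau μ ∘ iota μ`, the Laplacian `L = d h + h d` is `∑ ∂_μ tau μ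
+ (4 - p) k` in form degree `p` and antighost number `k`. Since `tau` lowers the number of
derivatives on antifields and `(L - k) ∂_μ = ∂_μ L`, every monomial is killed by a polynomial in `L`
with roots `(4 - p) k + j k`. For `p < 4` and `k > 0` these are nonzero, so any form `a` in these
degrees equals `Q(L) (L a)` for some polynomial `Q`. If `d a = 0`, this reads `a = d (Q(L) (h a))`.
As `tau` and `iota` never touch the gravitino, the construction stays inside the invariant
polynomials.

Part (2) is a descent. From `γ a + d b = 0` one gets `d (γ b) = 0`, hence `γ b` is `d`-exact by the
same homotopy on all forms. Induction on the form degree, applied to `b`, then allows one to assume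
`γ b = 0`. The cohomology of `γ` is represented by polynomials `β` in the invariants and the
undifferentiated ghosts: `∂_I C` with `I ≠ 0` and the symmetrized derivatives of `ψ` form
contractible pairs. So `b = β + γ e`.

On such `β`, `d` equals, up to `γ`-exact terms, the differential built from `barDeriv`, which treats
ghosts as constants because `∂_μ C = γ ψ_μ`. This differential kills `β`, since a `γ`-exact form of
that type is zero. The homotopy applies to it too, and gives `β = d β' - γ y`; the `γ`-exact
remainder of `b` is absorbed into the correction of `a`. -/

namespace Gravitino

open Polynomial

/-! ### Graded derivations and their commutators -/

section Derivations

variable {K : Type*} [Field K]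

theorem twist_twist (s t : ℕ) (a : LocalForm K) : twist s (twist t a) = twist (s + t) a := by
  have : (twist s).comp (twist t) = (twist (s + t) : LocalForm K →ₐ[K] LocalForm K) :=
    hom_ext fun x => by
      simp only [AlgHom.comp_apply, twist_gen, map_smul, smul_smul]
      congr 1
      ring
  exact DFunLike.congr_fun this a

theorem twist_two (a : LocalForm K) : twist 2 a = a := by
  have : twist 2 = AlgHom.id K (LocalForm K) := hom_ext fun x => by simp [twist_gen, pow_mul]
  rw [this]; rfl

theorem HasParity.twist {s : ℕ} {v : Gen → LocalForm K} (hv : HasParity s v) (t : ℕ) (x : Gen) :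
    twist t (v x) = (-1 : K) ^ (t * (x.parity + s)) • v x := by
  induction t with
  | zero => simp [twist_zero]
  | succ t ih =>
    rw [← twist_twist, hv x, map_smul, ih, smul_smul]
    congr 1
    ring

/-- `D` is a graded left derivation of parity `s`. -/
structure IsDer (s : ℕ) (D : LocalForm K →ₗ[K] LocalForm K) : Prop where
  mul : ∀ a b, D (a * b) = D a * b + twist s a * D b
  twist : ∀ t a, twist t (D a) = (-1 : K) ^ (t * s) • D (twist t a)

theorem isDer_deriv (s : ℕ) (v : Gen → LocalForm K) (hv : HasParity s v) :
    IsDer s (deriv s v hv) := by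
  have hone : deriv s v hv 1 = 0 := by simpa using deriv_mul s v hv 1 1
  refine ⟨deriv_mul s v hv, fun t a => ?_⟩
  induction a using induction_on with
  | hc r => simp [Algebra.algebraMap_eq_smul_one, hone]
  | hg x =>
    simp only [twist_gen, map_smul, deriv_gen, hv.twist, smul_smul]
    congr 1
    ring
  | hm a b h1 h2 =>
    simp only [deriv_mul, map_add, map_mul, h1, h2, smul_add, smul_mul_assoc, mul_smul_comm,
      twist_twist, add_comm]
  | ha a b h1 h2 => simp only [map_add, h1, h2, smul_add]

theorem IsDer.map_one {s : ℕ} {D : LocalForm K →ₗ[K] LocalForm K} (h : IsDer s D) : D 1 = 0 := by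
  simpa using h.mul 1 1

theorem IsDer.map_algebraMap {s : ℕ} {D : LocalForm K →ₗ[K] LocalForm K} (h : IsDer s D) (r : K) :
    D (algebraMap K _ r) = 0 := by
  rw [Algebra.algebraMap_eq_smul_one, map_smul, h.map_one, smul_zero]

theorem isDer_zero (s : ℕ) : IsDer s (0 : LocalForm K →ₗ[K] LocalForm K) :=
  ⟨by simp, by simp⟩

theorem IsDer.add {s : ℕ} {D E : LocalForm K →ₗ[K] LocalForm K} (hD : IsDer s D)
    (hE : IsDer s E) : IsDer s (D + E) := by
  refine ⟨fun a b => ?_, fun t a => ?_⟩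
  · simp only [LinearMap.add_apply, hD.mul, hE.mul, mul_add, add_mul]
    abel
  · simp only [LinearMap.add_apply, map_add, hD.twist, hE.twist, smul_add]

/-- Parities are natural numbers and matter only modulo 2; the commutator of two odd derivations
arrives with label `1 + 1`. -/
theorem IsDer.of_two {D : LocalForm K →ₗ[K] LocalForm K} (h : IsDer 2 D) : IsDer 0 D :=
  ⟨fun a b => by rw [h.mul, twist_two, twist_zero], fun t a => by rw [h.twist]; simp [mul_comm t]⟩

/-- The graded commutator of derivations is a derivation. -/
theorem IsDer.comm {s t : ℕ} {D E : LocalForm K →ₗ[K] LocalForm K} (hD : IsDer s D)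
    (hE : IsDer t E) : IsDer (s + t) (D ∘ₗ E - (-1 : K) ^ (s * t) • E ∘ₗ D) := by
  have hs : ((-1 : K) ^ (s * t)) * (-1 : K) ^ (s * t) = 1 := by
    rw [← mul_pow]; simp
  refine ⟨fun a b => ?_, fun r a => ?_⟩
  · simp only [LinearMap.sub_apply, LinearMap.comp_apply, LinearMap.smul_apply, hD.mul, hE.mul,
      map_add, twist_twist, hD.twist, hE.twist, mul_comm t s, smul_add, smul_mul_assoc, smul_smul,
      hs, one_smul, sub_mul, mul_sub, mul_smul_comm, add_comm t s]
    abel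
  · simp only [LinearMap.sub_apply, LinearMap.comp_apply, LinearMap.smul_apply, map_sub, map_smul,
      hD.twist, hE.twist, smul_sub, smul_smul]
    congr 2 <;> ring

theorem IsDer.eqOn_adjoin {s : ℕ} {D E : LocalForm K →ₗ[K] LocalForm K} (hD : IsDer s D)
    (hE : IsDer s E) {S : Set (LocalForm K)} (h : ∀ x ∈ S, D x = E x) {a : LocalForm K}
    (ha : a ∈ Algebra.adjoin K S) : D a = E a := by
  induction ha using Algebra.adjoin_induction with
  | mem x hx => exact h x hx
  | algebraMap r => rw [hD.map_algebraMap, hE.map_algebraMap]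
  | add x y _ _ h1 h2 => rw [map_add, map_add, h1, h2]
  | mul x y _ _ h1 h2 => rw [hD.mul, hE.mul, h1, h2]

theorem IsDer.ext_gen {s : ℕ} {D E : LocalForm K →ₗ[K] LocalForm K} (hD : IsDer s D)
    (hE : IsDer s E) (h : ∀ x, D (gen x) = E (gen x)) (a : LocalForm K) : D a = E a := by
  induction a using induction_on with
  | hc r => rw [hD.map_algebraMap, hE.map_algebraMap]
  | hg x => exact h x
  | hm x y h1 h2 => rw [hD.mul, hE.mul, h1, h2]
  | ha x y h1 h2 => rw [map_add, map_add, h1, h2]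

/-- The graded commutator of two derivations can be computed on the generators. -/
theorem IsDer.comm_eq {s t : ℕ} {D E F : LocalForm K →ₗ[K] LocalForm K} (hD : IsDer s D)
    (hE : IsDer t E) (hF : IsDer (s + t) F)
    (h : ∀ x, D (E (gen x)) = (-1 : K) ^ (s * t) • E (D (gen x)) + F (gen x)) (a : LocalForm K) :
    D (E a) = (-1 : K) ^ (s * t) • E (D a) + F a := by
  have := (hD.comm hE).ext_gen hF (fun x => by simp [h]) a
  simp only [LinearMap.sub_apply, LinearMap.comp_apply, LinearMap.smul_apply] at this
  rw [← this]
  abel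

theorem IsDer.comm_zero {s t : ℕ} {D E : LocalForm K →ₗ[K] LocalForm K} (hD : IsDer s D)
    (hE : IsDer t E) (h : ∀ x, D (E (gen x)) = (-1 : K) ^ (s * t) • E (D (gen x)))
    (a : LocalForm K) : D (E a) = (-1 : K) ^ (s * t) • E (D a) := by
  simpa using hD.comm_eq hE (isDer_zero _) (fun x => by simp [h]) a

theorem twist_mem_adjoin {S : Set (LocalForm K)} (t : ℕ)
    (h : ∀ x ∈ S, twist t x ∈ Algebra.adjoin K S) {a : LocalForm K}
    (ha : a ∈ Algebra.adjoin K S) : twist t a ∈ Algebra.adjoin K S := by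
  have : Algebra.adjoin K S ≤ (Algebra.adjoin K S).comap (twist t) := Algebra.adjoin_le h
  exact this ha

theorem IsDer.mem_adjoin {s : ℕ} {D : LocalForm K →ₗ[K] LocalForm K} (hD : IsDer s D)
    {S : Set (LocalForm K)} (ht : ∀ x ∈ S, Gravitino.twist s x ∈ Algebra.adjoin K S)
    (h : ∀ x ∈ S, D x ∈ Algebra.adjoin K S) {a : LocalForm K} (ha : a ∈ Algebra.adjoin K S) :
    D a ∈ Algebra.adjoin K S := by
  induction ha using Algebra.adjoin_induction with
  | mem x hx => exact h x hx
  | algebraMap r => rw [hD.map_algebraMap]; exact zero_mem _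
  | add x y _ _ h1 h2 => rw [map_add]; exact add_mem h1 h2
  | mul x y hx hy h1 h2 =>
    rw [hD.mul]
    exact add_mem (mul_mem h1 hy) (mul_mem (twist_mem_adjoin s ht hx) h2)

end Derivations

/-! ### Gradings by weights of the generators -/

section Weights

variable {K : Type*} [Field K] {M : Type*} [AddCommGroup M]

variable (K) in
/-- The span of the monomials of weight `w`, for the weights `f` of the generators. -/
noncomputable def wspan (f : Gen → M) (w : M) : Submodule K (LocalForm K) :=
  Submodule.span K {m | ∃ l : List Gen, m = (l.map gen).prod ∧ (l.map f).sum = w}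

theorem prod_mem_wspan (f : Gen → M) (l : List Gen) :
    (l.map gen).prod ∈ wspan K f (l.map f).sum :=
  Submodule.subset_span ⟨l, rfl, rfl⟩

theorem gen_mem_wspan (f : Gen → M) (x : Gen) : (gen x : LocalForm K) ∈ wspan K f (f x) := by
  simpa using prod_mem_wspan (K := K) f [x]

theorem one_mem_wspan (f : Gen → M) : (1 : LocalForm K) ∈ wspan K f 0 := by
  simpa using prod_mem_wspan (K := K) f []

theorem mul_mem_wspan {f : Gen → M} {v w : M} {a b : LocalForm K} (ha : a ∈ wspan K f v)
    (hb : b ∈ wspan K f w) : a * b ∈ wspan K f (v + w) := by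
  have h := Submodule.mul_mem_mul ha hb
  rw [wspan, wspan, Submodule.span_mul_span] at h
  refine Submodule.span_mono ?_ h
  rintro _ ⟨_, ⟨l, rfl, rfl⟩, _, ⟨l', rfl, rfl⟩, rfl⟩
  exact ⟨l ++ l', by simp, by simp⟩

theorem IsDer.mem_wspan {s : ℕ} {D : LocalForm K →ₗ[K] LocalForm K} (hD : IsDer s D)
    {f : Gen → M} {δ : M} (h : ∀ x, D (gen x) ∈ wspan K f (f x + δ)) {w : M} {a : LocalForm K}
    (ha : a ∈ wspan K f w) : D a ∈ wspan K f (w + δ) := by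
  induction ha using Submodule.span_induction with
  | mem x hx =>
    obtain ⟨l, rfl, rfl⟩ := hx
    induction l with
    | nil => simp [hD.map_one]
    | cons y l ih =>
      simp only [List.map_cons, List.prod_cons, List.sum_cons, hD.mul, twist_gen]
      refine add_mem ?_ ?_
      · have := mul_mem_wspan (h y) (prod_mem_wspan (K := K) f l)
        rwa [add_right_comm] at this
      · rw [add_assoc]
        exact mul_mem_wspan (Submodule.smul_mem _ _ (gen_mem_wspan f y)) ih
  | zero => simp
  | add x y _ _ h1 h2 => rw [map_add]; exact add_mem h1 h2
  | smul r x _ h1 => rw [map_smul]; exact Submodule.smul_mem _ _ h1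

/-- Euler's identity: by Leibniz, the eigenvalues of the factors of a monomial add up. It serves to
count antighost number and form degree. -/
theorem IsDer.eigen_wspan {D : LocalForm K →ₗ[K] LocalForm K} (hD : IsDer 0 D) {f : Gen → ℤ}
    (h : ∀ x, D (gen x) = (f x : K) • gen x) {w : ℤ} {a : LocalForm K}
    (ha : a ∈ wspan K f w) : D a = (w : K) • a := by
  induction ha using Submodule.span_induction with
  | mem x hx =>
    obtain ⟨l, rfl, rfl⟩ := hx
    induction l with
    | nil => simp [hD.map_one]
    | cons y l ih =>
      simp only [List.map_cons, List.prod_cons, List.sum_cons, hD.mul, twist_zero, ih, h]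
      simp [add_smul]
  | zero => simp
  | add x y _ _ h1 h2 => rw [map_add, h1, h2, smul_add]
  | smul r x _ h1 => rw [map_smul, h1, smul_comm]

theorem wspan_induction (f : Gen → M) {P : LocalForm K → Prop} (a : LocalForm K)
    (h : ∀ w, ∀ a ∈ wspan K f w, P a) (ha : ∀ a b, P a → P b → P (a + b)) : P a := by
  have key : a ∈ ⨆ w, wspan K f w := by
    induction a using induction_on with
    | hc r =>
      rw [Algebra.algebraMap_eq_smul_one]
      exact Submodule.smul_mem _ _ (Submodule.mem_iSup_of_mem 0 (one_mem_wspan f))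
    | hg x => exact Submodule.mem_iSup_of_mem _ (gen_mem_wspan f x)
    | hm a b h1 h2 =>
      induction h1 using Submodule.iSup_induction' with
      | mem v a ha =>
        induction h2 using Submodule.iSup_induction' with
        | mem w b hb => exact Submodule.mem_iSup_of_mem _ (mul_mem_wspan ha hb)
        | zero => simp
        | add x y _ _ h1 h2 => rw [mul_add]; exact add_mem h1 h2
      | zero => simp
      | add x y _ _ h1 h2 => rw [add_mul]; exact add_mem h1 h2
    | ha a b h1 h2 => exact add_mem h1 h2
  induction key using Submodule.iSup_induction' with
  | mem v a ha => exact h v a ha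
  | zero => exact h 0 0 (zero_mem _)
  | add x y _ _ h1 h2 => exact ha x y h1 h2

/-- The algebra homomorphism recording the weight of every monomial. -/
noncomputable def weightHom (f : Gen → M) : LocalForm K →ₐ[K] AddMonoidAlgebra (LocalForm K) M :=
  lift (fun x => AddMonoidAlgebra.single (f x) (gen x)) (by
    intro x y
    rw [AddMonoidAlgebra.single_mul_single, AddMonoidAlgebra.single_mul_single, gen_mul_gen x y,
      AddMonoidAlgebra.smul_single, add_comm])

/-- The projection onto the weight `w` part. -/
noncomputable def proj (f : Gen → M) (w : M) : LocalForm K →ₗ[K] LocalForm K where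
  toFun a := (weightHom f a).coeff w
  map_add' a b := by simp
  map_smul' r a := by simp

/-- The algebra is given by generators and relations, so the independence of the weight spaces is
not evident. It follows because the relations are homogeneous: tagging each generator with its
weight is a well-defined homomorphism, whose coefficients are the homogeneous components. -/
theorem weightHom_of_mem {f : Gen → M} {v : M} {a : LocalForm K} (ha : a ∈ wspan K f v) :
    weightHom f a = AddMonoidAlgebra.single v a := by
  induction ha using Submodule.span_induction with
  | mem x hx =>
    obtain ⟨l, rfl, rfl⟩ := hx
    induction l with
    | nil => simp [AddMonoidAlgebra.one_def]
    | cons y l ih =>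
      simp only [List.map_cons, List.prod_cons, List.sum_cons, map_mul, ih]
      rw [weightHom, lift_gen, AddMonoidAlgebra.single_mul_single]
  | zero => simp
  | add x y _ _ h1 h2 => rw [map_add, h1, h2, AddMonoidAlgebra.single_add]
  | smul r x _ h1 => rw [map_smul, h1, AddMonoidAlgebra.smul_single]

theorem proj_of_mem {f : Gen → M} {v : M} {a : LocalForm K} (ha : a ∈ wspan K f v) :
    proj f v a = a := by
  simp [proj, weightHom_of_mem ha]

theorem proj_of_mem_of_ne {f : Gen → M} {v w : M} (hvw : v ≠ w) {a : LocalForm K}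
    (ha : a ∈ wspan K f v) : proj f w a = 0 := by
  simp [proj, weightHom_of_mem ha, hvw]

theorem proj_mem (f : Gen → M) (w : M) (a : LocalForm K) : proj f w a ∈ wspan K f w := by
  induction a using wspan_induction f with
  | h v a ha =>
    by_cases hvw : v = w
    · subst hvw; rwa [proj_of_mem ha]
    · rw [proj_of_mem_of_ne hvw ha]; exact zero_mem _
  | ha a b h1 h2 => rw [map_add]; exact add_mem h1 h2

theorem proj_comm {f : Gen → M} {δ : M} {D : LocalForm K →ₗ[K] LocalForm K}
    (h : ∀ w, ∀ a ∈ wspan K f w, D a ∈ wspan K f (w + δ)) (w : M) (a : LocalForm K) :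
    proj f (w + δ) (D a) = D (proj f w a) := by
  induction a using wspan_induction f with
  | h v a ha =>
    by_cases hvw : v = w
    · subst hvw; rw [proj_of_mem ha, proj_of_mem (h v a ha)]
    · rw [proj_of_mem_of_ne hvw ha, proj_of_mem_of_ne (by simpa using hvw) (h v a ha), map_zero]
  | ha a b h1 h2 => simp only [map_add, h1, h2]

/-- A subalgebra generated by homogeneous elements is spanned by their products, which are again
homogeneous, so it contains the components of its elements. -/
theorem proj_mem_adjoin {f : Gen → M} {S : Set (LocalForm K)}
    (hS : ∀ x ∈ S, ∃ v, x ∈ wspan K f v) (w : M) {a : LocalForm K}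
    (ha : a ∈ Algebra.adjoin K S) : proj f w a ∈ Algebra.adjoin K S := by
  rw [← Subalgebra.mem_toSubmodule, Algebra.adjoin_eq_span] at ha
  induction ha using Submodule.span_induction with
  | mem x hx =>
    have : ∃ v, x ∈ wspan K f v := by
      induction hx using Submonoid.closure_induction with
      | mem x hx => exact hS x hx
      | one => exact ⟨0, one_mem_wspan f⟩
      | mul x y _ _ h1 h2 =>
        obtain ⟨v, hv⟩ := h1
        obtain ⟨v', hv'⟩ := h2
        exact ⟨_, mul_mem_wspan hv hv'⟩
    obtain ⟨v, hv⟩ := this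
    by_cases hvw : v = w
    · subst hvw
      rw [proj_of_mem hv]
      exact (Submonoid.closure_le (S := (Algebra.adjoin K S).toSubmonoid)).2 Algebra.subset_adjoin hx
    · rw [proj_of_mem_of_ne hvw hv]; exact zero_mem _
  | zero => simp
  | add x y _ _ h1 h2 => rw [map_add]; exact add_mem h1 h2
  | smul r x _ h1 => rw [map_smul]; exact Subalgebra.smul_mem _ h1 _

end Weights


/-! ### Inverting an operator by polynomials in it -/

section LinearAlgebra

variable {K V : Type*} [Field K] [AddCommGroup V] [Module K V]

theorem aeval_apply_mem {S : Submodule K V} {T : Module.End K V} (hS : ∀ x ∈ S, T x ∈ S)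
    (P : K[X]) {x : V} (hx : x ∈ S) : aeval T P x ∈ S := by
  induction P using Polynomial.induction_on' with
  | add p q h1 h2 => rw [map_add]; exact add_mem h1 h2
  | monomial n r =>
    rw [aeval_monomial, Module.End.mul_apply, Module.algebraMap_end_apply]
    refine S.smul_mem _ ?_
    induction n with
    | zero => simpa using hx
    | succ n ih => rw [pow_succ', Module.End.mul_apply]; exact hS _ ih

/-- If `f` intertwines `T` and `T'` on a `T`-stable subspace, then it intertwines all polynomials
in `T` and `T'` there. -/
theorem aeval_intertwine {S : Submodule K V} {T T' f : Module.End K V}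
    (hS : ∀ x ∈ S, T x ∈ S) (h : ∀ x ∈ S, T' (f x) = f (T x)) (P : K[X]) {x : V} (hx : x ∈ S) :
    aeval T' P (f x) = f (aeval T P x) := by
  induction P using Polynomial.induction_on' with
  | add p q h1 h2 => simp only [map_add, LinearMap.add_apply, h1, h2]
  | monomial n r =>
    simp only [aeval_monomial, Module.End.mul_apply, Module.algebraMap_end_apply, map_smul]
    congr 1
    have : (T ^ n) x ∈ S ∧ (T' ^ n) (f x) = f ((T ^ n) x) := by
      induction n with
      | zero => simpa using hx
      | succ n ih =>
        simp only [pow_succ', Module.End.mul_apply]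
        exact ⟨hS _ ih.1, by rw [ih.2, h _ ih.1]⟩
    exact this.2

/-- The vectors `v` that can be recovered from `T v` by a polynomial in `T`. -/
def recoverable (T : Module.End K V) : Submodule K V where
  carrier := {v | ∃ Q : K[X], aeval T Q (T v) = v}
  zero_mem' := ⟨0, by simp⟩
  smul_mem' := by
    rintro r v ⟨Q, hQ⟩
    exact ⟨Q, by simp only [map_smul, hQ]⟩
  add_mem' := by
    rintro v w ⟨Q, hQ⟩ ⟨R, hR⟩
    -- `1 - X (Q + R - X Q R) = (1 - X Q) (1 - X R)`, where the first factor kills `v` and the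
    -- second kills `w`.
    refine ⟨Q + R - X * (Q * R), ?_⟩
    have hc : ∀ (P P' : K[X]) (z : V), aeval T P (aeval T P' z) = aeval T P' (aeval T P z) := by
      intro P P' z
      rw [← Module.End.mul_apply, ← map_mul, mul_comm, map_mul, Module.End.mul_apply]
    have hT : ∀ (P : K[X]) (z : V), T (aeval T P z) = aeval T P (T z) := fun P z => by
      simpa using hc X P z
    have e1 : aeval T (X * (Q * R)) (T v) = aeval T R (T v) := by
      simp only [map_mul, Module.End.mul_apply, aeval_X]
      rw [hc Q R, hQ, hT]
    have e2 : aeval T (X * (Q * R)) (T w) = aeval T Q (T w) := by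
      simp only [map_mul, Module.End.mul_apply, aeval_X]
      rw [hR, hT]
    simp only [map_add, map_sub, LinearMap.add_apply, LinearMap.sub_apply, e1, e2, hQ, hR]
    abel

/-- Write `P = X P₁ + P(0)`: then `P(0) v = -P₁(T) (T v)`, and `P(0)` can be divided out. -/
theorem mem_recoverable_of_aeval {T : Module.End K V} {P : K[X]} (h0 : P.eval 0 ≠ 0) {v : V}
    (hv : aeval T P v = 0) : v ∈ recoverable T := by
  refine ⟨C (-(P.eval 0)⁻¹) * P.divX, ?_⟩
  rw [← P.divX_mul_X_add, map_add, map_mul, aeval_X, aeval_C, LinearMap.add_apply,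
    Module.End.mul_apply, Module.algebraMap_end_apply, coeff_zero_eq_eval_zero] at hv
  rw [map_mul, aeval_C, Module.End.mul_apply, Module.algebraMap_end_apply, eq_neg_of_add_eq_zero_left hv,
    smul_neg, smul_smul, neg_mul, inv_mul_cancel₀ h0]
  simp

end LinearAlgebra

/-! ### Contractions, antifield lowering operators and ghost-blind derivatives -/

section Operators

variable {K : Type*} [Field K]

/-- Form degree, antighost number and pure ghost number. -/
def deg (x : Gen) : ℤ × ℤ × ℤ := (x.formDeg, x.antigh, x.puregh)

theorem homogeneous_eq (p k g : ℤ) : homogeneous K p k g = wspan K deg (p, k, g) := by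
  have : ∀ l : List Gen, (l.map deg).sum =
      ((l.map Gen.formDeg).sum, (l.map Gen.antigh).sum, (l.map Gen.puregh).sum) := by
    intro l
    induction l with
    | nil => rfl
    | cons x l ih => simp only [List.map_cons, List.sum_cons, ih]; rfl
  simp only [homogeneous, wspan, this, Prod.mk.injEq]

theorem wspan_comp_le {M N : Type*} [AddCommGroup M] [AddCommGroup N] (f : Gen → M) (φ : M →+ N)
    (w : M) : wspan K f w ≤ wspan K (fun x => φ (f x)) (φ w) := by
  refine Submodule.span_mono ?_
  rintro _ ⟨l, rfl, rfl⟩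
  exact ⟨l, rfl, by simp [map_list_sum, Function.comp_def]⟩

theorem gen_mem_wspan_of_eq {M : Type*} [AddCommGroup M] {f : Gen → M} {x : Gen} {w : M}
    (h : f x = w) : (gen x : LocalForm K) ∈ wspan K f w := h ▸ gen_mem_wspan f x

/-- Values of the derivation counting the antighost number. -/
noncomputable def antighVal (x : Gen) : LocalForm K := (x.antigh : K) • gen x

theorem antighVal_parity : HasParity 0 (antighVal (K := K)) := by
  intro x
  rw [antighVal, map_smul, twist_gen, smul_comm, one_mul, add_zero]

/-- The derivation counting the antighost number. -/
noncomputable def antighDeriv : LocalForm K →ₗ[K] LocalForm K :=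
  deriv 0 antighVal antighVal_parity

/-- Values of the contraction with `∂/∂x^μ`. -/
noncomputable def iotaVal (μ : Fin 4) : Gen → LocalForm K
  | .dx ν => if μ = ν then 1 else 0
  | _ => 0

theorem iotaVal_parity (μ : Fin 4) : HasParity 1 (iotaVal (K := K) μ) := by
  intro x
  cases x with
  | dx ν => simp only [iotaVal]; split_ifs <;> simp [Gen.parity]
  | _ => simp [iotaVal]

/-- The contraction `∂/∂(dx^μ)`, an odd derivation. -/
noncomputable def iota (μ : Fin 4) : LocalForm K →ₗ[K] LocalForm K :=
  deriv 1 (iotaVal μ) (iotaVal_parity μ)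

/-- Values of the derivation lowering by `1` the number of derivatives `∂_μ` of the antifields. -/
noncomputable def tauVal (μ : Fin 4) : Gen → LocalForm K
  | .psiStar ν A I => (I μ : K) • gen (.psiStar ν A (I - Pi.single μ 1))
  | .ghostStar A I => (2 * I μ : K) • gen (.ghostStar A (I - Pi.single μ 1))
  | _ => 0

theorem tauVal_parity (μ : Fin 4) : HasParity 0 (tauVal (K := K) μ) := by
  intro x
  cases x <;> simp [tauVal, twist_gen, Gen.parity]

/-- The even derivation lowering by `1` the number of derivatives `∂_μ` of the antifields. -/
noncomputable def tau (μ : Fin 4) : LocalForm K →ₗ[K] LocalForm K :=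
  deriv 0 (tauVal μ) (tauVal_parity μ)

/-- Values of the total derivative that ignores the ghosts. -/
noncomputable def barVal (μ : Fin 4) : Gen → LocalForm K
  | .ghost _ _ => 0
  | x => partialVal μ x

theorem barVal_parity (μ : Fin 4) : HasParity 0 (barVal (K := K) μ) := by
  intro x
  cases x <;> simp [barVal, partialVal, twist_gen, Gen.parity]

/-- The even derivation that acts as `∂_μ` on all fields but the ghosts, which it annihilates. -/
noncomputable def barDeriv (μ : Fin 4) : LocalForm K →ₗ[K] LocalForm K :=
  deriv 0 (barVal μ) (barVal_parity μ)

theorem totalDeriv_isDer (μ : Fin 4) : IsDer 0 (totalDeriv (K := K) μ) := isDer_deriv _ _ _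
theorem barDeriv_isDer (μ : Fin 4) : IsDer 0 (barDeriv (K := K) μ) := isDer_deriv _ _ _
theorem tau_isDer (μ : Fin 4) : IsDer 0 (tau (K := K) μ) := isDer_deriv _ _ _
theorem iota_isDer (μ : Fin 4) : IsDer 1 (iota (K := K) μ) := isDer_deriv _ _ _
theorem gamma_isDer : IsDer 1 (gamma (K := K)) := isDer_deriv _ _ _
theorem antighDeriv_isDer : IsDer 0 (antighDeriv (K := K)) := isDer_deriv _ _ _

theorem totalDeriv_gen (μ : Fin 4) (x : Gen) :
    totalDeriv μ (gen x : LocalForm K) = partialVal μ x := deriv_gen _ _ _ _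
theorem barDeriv_gen (μ : Fin 4) (x : Gen) :
    barDeriv μ (gen x : LocalForm K) = barVal μ x := deriv_gen _ _ _ _
theorem tau_gen (μ : Fin 4) (x : Gen) :
    tau μ (gen x : LocalForm K) = tauVal μ x := deriv_gen _ _ _ _
theorem iota_gen (μ : Fin 4) (x : Gen) :
    iota μ (gen x : LocalForm K) = iotaVal μ x := deriv_gen _ _ _ _
theorem gamma_gen (x : Gen) : gamma (gen x : LocalForm K) = gammaVal x := deriv_gen _ _ _ _
theorem antighDeriv_gen (x : Gen) :
    antighDeriv (gen x : LocalForm K) = (x.antigh : K) • gen x := deriv_gen _ _ _ _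

/-- Left multiplication by a differential turns derivations into derivations. -/
theorem IsDer.dx_mul {s : ℕ} {D : LocalForm K →ₗ[K] LocalForm K} (hD : IsDer s D) (μ : Fin 4) :
    IsDer (1 + s) (LinearMap.mulLeft K (gen (.dx μ)) ∘ₗ D) := by
  have hc : ∀ a : LocalForm K, gen (.dx μ) * a = Gravitino.twist 1 a * gen (.dx μ) := fun a => by
    rw [mul_gen]
    change _ = gen (.dx μ) * Gravitino.twist 1 (Gravitino.twist 1 a)
    rw [twist_twist, twist_two]
  refine ⟨fun a b => ?_, fun t a => ?_⟩
  · simp only [LinearMap.comp_apply, LinearMap.mulLeft_apply, hD.mul, mul_add, ← mul_assoc]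
    rw [hc (Gravitino.twist s a), twist_twist]
  · simp only [LinearMap.comp_apply, LinearMap.mulLeft_apply, map_mul, hD.twist, twist_gen,
      smul_mul_assoc, mul_smul_comm, smul_smul]
    congr 1
    simp only [Gen.parity]
    ring

theorem isDer_sum {s : ℕ} {D : Fin 4 → LocalForm K →ₗ[K] LocalForm K} (h : ∀ μ, IsDer s (D μ)) :
    IsDer s (∑ μ, D μ) := by
  simp only [Fin.sum_univ_four]
  exact (((h 0).add (h 1)).add (h 2)).add (h 3)

theorem iota_dx_mul (μ ν : Fin 4) (a : LocalForm K) :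
    iota μ (gen (.dx ν) * a) = (if μ = ν then a else 0) - gen (.dx ν) * iota μ a := by
  rw [(iota_isDer μ).mul, iota_gen, twist_gen]
  split_ifs with h <;> simp [iotaVal, h, Gen.parity, sub_eq_add_neg]

theorem tau_dx_mul (μ ν : Fin 4) (a : LocalForm K) :
    tau μ (gen (.dx ν) * a) = gen (.dx ν) * tau μ a := by
  rw [(tau_isDer μ).mul, tau_gen, twist_zero]
  simp [tauVal]

theorem iota_mem {p k g : ℤ} (μ : Fin 4) {a : LocalForm K} (ha : a ∈ wspan K deg (p, k, g)) :
    iota μ a ∈ wspan K deg (p - 1, k, g) := by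
  have := (iota_isDer μ).mem_wspan (f := deg) (δ := (-1, 0, 0)) (fun x => ?_) ha
  · simpa [sub_eq_add_neg] using this
  · rw [iota_gen]
    cases x with
    | dx ν =>
      simp only [iotaVal]
      split_ifs
      · exact one_mem_wspan deg
      · exact zero_mem _
    | _ => exact zero_mem _

theorem dx_mul_mem {p k g : ℤ} (μ : Fin 4) {a : LocalForm K} (ha : a ∈ wspan K deg (p, k, g)) :
    gen (.dx μ) * a ∈ wspan K deg (p + 1, k, g) := by
  have := mul_mem_wspan (gen_mem_wspan deg (.dx μ)) ha
  simpa [deg, Gen.formDeg, Gen.antigh, Gen.puregh, add_comm] using this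

/-- The number of derivatives of an antifield. -/
def antifieldJet : Gen → ℤ
  | .psiStar _ _ I => ∑ ν, (I ν : ℤ)
  | .ghostStar _ I => ∑ ν, (I ν : ℤ)
  | _ => 0

theorem antifieldJet_nonneg (x : Gen) : 0 ≤ antifieldJet x := by
  cases x <;> simp only [antifieldJet, le_refl] <;> positivity

theorem sum_sub_single {I : MultiIndex} {μ : Fin 4} (h : I μ ≠ 0) :
    (∑ ν, ((I - Pi.single μ 1 : MultiIndex) ν : ℤ)) = (∑ ν, (I ν : ℤ)) - 1 := by
  have : ∀ ν, ((I - Pi.single μ 1 : MultiIndex) ν : ℤ) = I ν - (Pi.single μ 1 : Fin 4 → ℤ) ν := by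
    intro ν
    by_cases hν : ν = μ
    · subst hν
      simp only [Pi.sub_apply, Pi.single_eq_same]
      omega
    · simp [hν]
  rw [Finset.sum_congr rfl fun ν _ => this ν, Finset.sum_sub_distrib, Finset.sum_pi_single']
  simp

/-- Degrees together with the number of derivatives of the antifields. -/
def jetDeg (x : Gen) : (ℤ × ℤ × ℤ) × ℤ := (deg x, antifieldJet x)

theorem tau_mem_jet {w : ℤ × ℤ × ℤ} {m : ℤ} (μ : Fin 4) {a : LocalForm K}
    (ha : a ∈ wspan K jetDeg (w, m)) : tau μ a ∈ wspan K jetDeg (w, m - 1) := by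
  have := (tau_isDer μ).mem_wspan (f := jetDeg) (δ := (0, -1)) (fun x => ?_) ha
  · simpa [sub_eq_add_neg] using this
  · rw [tau_gen]
    cases x with
    | psiStar ν A I =>
      by_cases h : I μ = 0
      · simp [tauVal, h]
      · refine Submodule.smul_mem _ _ (gen_mem_wspan_of_eq ?_)
        simp only [jetDeg, antifieldJet, sum_sub_single h]
        simp [deg, Gen.formDeg, Gen.antigh, Gen.puregh, sub_eq_add_neg]
    | ghostStar A I =>
      by_cases h : I μ = 0
      · simp [tauVal, h]
      · refine Submodule.smul_mem _ _ (gen_mem_wspan_of_eq ?_)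
        simp only [jetDeg, antifieldJet, sum_sub_single h]
        simp [deg, Gen.formDeg, Gen.antigh, Gen.puregh, sub_eq_add_neg]
    | _ => exact zero_mem _

theorem tau_mem {w : ℤ × ℤ × ℤ} (μ : Fin 4) {a : LocalForm K}
    (ha : a ∈ wspan K deg w) : tau μ a ∈ wspan K deg w := by
  have := (tau_isDer μ).mem_wspan (f := deg) (δ := 0) (fun x => ?_) ha
  · simpa using this
  · rw [tau_gen]
    cases x with
    | psiStar ν A I =>
      exact Submodule.smul_mem _ _ (gen_mem_wspan_of_eq
        (by simp [deg, Gen.formDeg, Gen.antigh, Gen.puregh]))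
    | ghostStar A I =>
      exact Submodule.smul_mem _ _ (gen_mem_wspan_of_eq
        (by simp [deg, Gen.formDeg, Gen.antigh, Gen.puregh]))
    | _ => exact zero_mem _

theorem wspan_jet_le (w : ℤ × ℤ × ℤ) (m : ℤ) : wspan K jetDeg (w, m) ≤ wspan K deg w :=
  wspan_comp_le jetDeg (AddMonoidHom.fst _ _) (w, m)

/-- This makes `tau` locally nilpotent, which is what ends the induction in
`IsTotalDeriv.aeval_ladder`. -/
theorem eq_zero_of_jet_neg {w : ℤ × ℤ × ℤ} {m : ℤ} (hm : m < 0) {a : LocalForm K}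
    (ha : a ∈ wspan K jetDeg (w, m)) : a = 0 := by
  have h := wspan_comp_le jetDeg (AddMonoidHom.snd (ℤ × ℤ × ℤ) ℤ) (w, m) ha
  have hbot : wspan K (fun x => AddMonoidHom.snd (ℤ × ℤ × ℤ) ℤ (jetDeg x))
      (AddMonoidHom.snd (ℤ × ℤ × ℤ) ℤ (w, m)) = ⊥ := by
    refine Submodule.span_eq_bot.2 ?_
    rintro _ ⟨l, -, hl⟩
    have : 0 ≤ (l.map fun x => AddMonoidHom.snd (ℤ × ℤ × ℤ) ℤ (jetDeg x)).sum := by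
      refine List.sum_nonneg fun y hy => ?_
      obtain ⟨x, -, rfl⟩ := List.mem_map.1 hy
      exact antifieldJet_nonneg x
    rw [hl] at this
    exact absurd this (not_le.2 hm)
  rwa [hbot] at h

theorem antighDeriv_apply {p k g : ℤ} {a : LocalForm K} (ha : a ∈ wspan K deg (p, k, g)) :
    antighDeriv a = (k : K) • a :=
  antighDeriv_isDer.eigen_wspan antighDeriv_gen
    (wspan_comp_le deg ((AddMonoidHom.fst _ _).comp (AddMonoidHom.snd _ _)) (p, k, g) ha)

theorem sum_dx_mul_iota {p k g : ℤ} {a : LocalForm K} (ha : a ∈ wspan K deg (p, k, g)) :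
    ∑ μ, gen (.dx μ) * iota μ a = (p : K) • a := by
  have hD : IsDer 0 (∑ μ, LinearMap.mulLeft K (gen (.dx μ) : LocalForm K) ∘ₗ iota μ) :=
    (isDer_sum fun μ => (iota_isDer μ).dx_mul μ).of_two
  have := hD.eigen_wspan (f := Gen.formDeg) (fun x => ?_)
    (wspan_comp_le deg (AddMonoidHom.fst _ _) (p, k, g) ha)
  · simpa using this
  · simp only [LinearMap.sum_apply, LinearMap.comp_apply, LinearMap.mulLeft_apply, iota_gen]
    cases x <;> simp [iotaVal, Gen.formDeg]

end Operators


/-! ### The algebraic Poincaré lemma in positive antighost number -/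

section Poincare

variable {K : Type*} [Field K]

/-- Commuting even operators with the same commutation relations as the total derivatives. -/
structure IsTotalDeriv (D : Fin 4 → LocalForm K →ₗ[K] LocalForm K) : Prop where
  isDer : ∀ μ, IsDer 0 (D μ)
  dx : ∀ μ ν, D μ (gen (.dx ν)) = 0
  comm : ∀ μ ν a, D μ (D ν a) = D ν (D μ a)
  comm_iota : ∀ μ ν a, iota μ (D ν a) = D ν (iota μ a)
  comm_tau : ∀ μ ν a, tau μ (D ν a) = D ν (tau μ a) + if μ = ν then antighDeriv a else 0
  mem : ∀ μ w, ∀ a ∈ wspan K deg w, D μ a ∈ wspan K deg w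

/-- The differential `dx^μ D_μ`. -/
noncomputable def diff (D : Fin 4 → LocalForm K →ₗ[K] LocalForm K) :
    LocalForm K →ₗ[K] LocalForm K :=
  ∑ μ : Fin 4, (LinearMap.mulLeft K (gen (.dx μ))).comp (D μ)

theorem diff_apply (D : Fin 4 → LocalForm K →ₗ[K] LocalForm K) (a : LocalForm K) :
    diff D a = ∑ μ, gen (.dx μ) * D μ a := by
  simp [diff]

/-- The homotopy operator for `diff D`. -/
noncomputable def homotopy : LocalForm K →ₗ[K] LocalForm K := ∑ μ : Fin 4, tau μ ∘ₗ iota μ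

theorem homotopy_apply (a : LocalForm K) : homotopy a = ∑ μ, tau μ (iota μ a) := by
  simp [homotopy]

theorem homotopy_mem {p k g : ℤ} {a : LocalForm K} (ha : a ∈ wspan K deg (p, k, g)) :
    homotopy a ∈ wspan K deg (p - 1, k, g) := by
  rw [homotopy_apply]
  exact sum_mem fun μ _ => tau_mem μ (iota_mem μ ha)

variable {D : Fin 4 → LocalForm K →ₗ[K] LocalForm K}

theorem IsTotalDeriv.diff_mem (hD : IsTotalDeriv D) {p k g : ℤ} {a : LocalForm K}
    (ha : a ∈ wspan K deg (p, k, g)) : diff D a ∈ wspan K deg (p + 1, k, g) := by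
  rw [diff_apply]
  exact sum_mem fun μ _ => dx_mul_mem μ (hD.mem μ _ a ha)

theorem IsTotalDeriv.map_dx_mul (hD : IsTotalDeriv D) (μ ν : Fin 4) (a : LocalForm K) :
    D μ (gen (.dx ν) * a) = gen (.dx ν) * D μ a := by
  rw [(hD.isDer μ).mul, hD.dx, zero_mul, zero_add, twist_zero]

theorem dx_mul_dx_mul (μ ν : Fin 4) (a : LocalForm K) :
    gen (.dx μ) * (gen (.dx ν) * a) = -(gen (.dx ν) * (gen (.dx μ) * a)) := by
  rw [← mul_assoc, ← mul_assoc, gen_mul_gen]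
  simp [Gen.parity]

theorem IsTotalDeriv.diff_diff [CharZero K] (hD : IsTotalDeriv D) (a : LocalForm K) :
    diff D (diff D a) = 0 := by
  have h : diff D (diff D a) = -diff D (diff D a) := by
    conv_lhs => simp only [diff_apply, map_sum, hD.map_dx_mul, Finset.mul_sum]
    conv_rhs => simp only [diff_apply, map_sum, hD.map_dx_mul, Finset.mul_sum]
    conv_lhs => rw [Finset.sum_comm]
    rw [← Finset.sum_neg_distrib]
    refine Finset.sum_congr rfl fun μ _ => ?_
    rw [← Finset.sum_neg_distrib]
    refine Finset.sum_congr rfl fun ν _ => ?_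
    rw [dx_mul_dx_mul μ ν, hD.comm μ ν]
  have h2 : (2 : K) • diff D (diff D a) = 0 := by
    rw [two_smul]
    nth_rewrite 1 [h]
    exact neg_add_cancel _
  exact (smul_eq_zero.1 h2).resolve_left two_ne_zero

/-- The Laplacian of `diff D` and the homotopy operator. -/
noncomputable def laplacian (D : Fin 4 → LocalForm K →ₗ[K] LocalForm K) :
    Module.End K (LocalForm K) :=
  diff D ∘ₗ homotopy + homotopy ∘ₗ diff D

/-- Commuting `iota μ` past `dx^ν` and `tau μ` past `D ν` leaves three contributions: `∑ D μ tau μ`,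
one copy of `k` for each of the four directions, and `-k` times `∑ dx^μ iota μ`, which counts the
form degree. The remaining double sum cancels against `d h`. -/
theorem IsTotalDeriv.laplacian_apply (hD : IsTotalDeriv D) {p k g : ℤ} {a : LocalForm K}
    (ha : a ∈ wspan K deg (p, k, g)) :
    laplacian D a = ∑ μ, D μ (tau μ a) + ((4 - p) * k : K) • a := by
  have h1 : homotopy (diff D a) = ∑ μ, (D μ (tau μ a) + (k : K) • a)
      - ∑ ν, ∑ μ, gen (.dx ν) * D ν (tau μ (iota μ a))
      - ∑ μ, gen (.dx μ) * ((k : K) • iota μ a) := by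
    simp only [homotopy_apply, diff_apply, map_sum, iota_dx_mul, hD.comm_iota, map_sub, tau_dx_mul,
      hD.comm_tau, apply_ite (tau _), map_zero, Finset.sum_sub_distrib, antighDeriv_apply ha,
      antighDeriv_apply (iota_mem _ ha), mul_add, mul_ite, mul_zero, Finset.sum_add_distrib]
    rw [Finset.sum_comm]
    simp only [Finset.sum_add_distrib, Finset.sum_ite_eq, Finset.sum_ite_eq', Finset.mem_univ, if_true]
    abel
  have h2 : diff D (homotopy a) = ∑ ν, ∑ μ, gen (.dx ν) * D ν (tau μ (iota μ a)) := by
    simp only [homotopy_apply, diff_apply, map_sum]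
    exact Finset.sum_comm
  simp only [laplacian, LinearMap.add_apply, LinearMap.comp_apply, h1, h2, mul_smul_comm,
    ← Finset.smul_sum, sum_dx_mul_iota ha, Finset.sum_add_distrib, Finset.sum_const,
    Finset.card_univ, Fintype.card_fin, smul_smul]
  rw [sub_mul, sub_smul, mul_comm (p : K), mul_comm (4 : K), ← Nat.cast_smul_eq_nsmul K, smul_smul]
  push_cast
  abel

theorem IsTotalDeriv.laplacian_mem_wspan (hD : IsTotalDeriv D) {w : ℤ × ℤ × ℤ} {a : LocalForm K}
    (ha : a ∈ wspan K deg w) : laplacian D a ∈ wspan K deg w := by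
  obtain ⟨p, k, g⟩ := w
  rw [hD.laplacian_apply ha]
  exact add_mem (sum_mem fun μ _ => hD.mem μ _ _ (tau_mem μ ha)) (Submodule.smul_mem _ _ ha)

/-- `D μ` raises the eigenvalue of the Laplacian by `k`, as a creation operator does; the extra `k`
comes from `[tau μ, D μ]`. -/
theorem IsTotalDeriv.laplacian_comm (hD : IsTotalDeriv D) {p k g : ℤ} {a : LocalForm K}
    (ha : a ∈ wspan K deg (p, k, g)) (μ : Fin 4) :
    (laplacian D - algebraMap K _ (k : K)) (D μ a) = D μ (laplacian D a) := by
  rw [LinearMap.sub_apply, Module.algebraMap_end_apply, hD.laplacian_apply (hD.mem μ _ a ha),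
    hD.laplacian_apply ha]
  simp only [hD.comm_tau, map_add, map_sum, map_smul, Finset.sum_add_distrib, apply_ite (D _), map_zero,
    Finset.sum_ite_eq', Finset.mem_univ, if_true, antighDeriv_apply ha]
  rw [Finset.sum_congr rfl fun ν _ => hD.comm ν μ (tau ν a)]
  abel

/-- The polynomial with roots `c, c + k, …, c + (m - 1) k`. -/
noncomputable def ladder (k c : K) : ℕ → K[X]
  | 0 => 1
  | m + 1 => (ladder k c m).comp (X - C k) * (X - C c)

/-- Only `j = 0` is needed later; the other points are there because substituting `X - k` moves the
evaluation point from `-(j k)` to `-((j + 1) k)`. -/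
theorem eval_ladder_ne_zero {k c : K} (h : ∀ j : ℕ, c + j * k ≠ 0) (m j : ℕ) :
    (ladder k c m).eval (-(j * k)) ≠ 0 := by
  induction m generalizing j with
  | zero => simp [ladder]
  | succ m ih =>
    simp only [ladder, eval_mul, eval_comp, eval_sub, eval_X, eval_C]
    refine mul_ne_zero ?_ ?_
    · have e : -(j * k) - k = -((j + 1 : ℕ) * k) := by
        push_cast
        ring
      rw [e]
      exact ih _
    · rw [neg_sub_left, neg_ne_zero, add_comm]
      simpa [add_comm] using h j

/-- The factor `L - (4 - p) k` turns `a` into `∑ D μ (tau μ a)`, where `tau μ a` has one antifield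
derivative fewer. Moving the other factors past `D μ` replaces `L - k` by `L`, and induction
applies. -/
theorem IsTotalDeriv.aeval_ladder (hD : IsTotalDeriv D) {p k g : ℤ} (m : ℕ) {n : ℤ} (hn : n < m)
    {a : LocalForm K} (ha : a ∈ wspan K jetDeg ((p, k, g), n)) :
    aeval (laplacian D) (ladder (k : K) ((4 - p) * k) m) a = 0 := by
  induction m generalizing n a with
  | zero => rw [eq_zero_of_jet_neg (by simpa using hn) ha, map_zero]
  | succ m ih =>
    rw [ladder, map_mul, Module.End.mul_apply, aeval_comp]
    simp only [map_sub, aeval_X, aeval_C]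
    rw [LinearMap.sub_apply, Module.algebraMap_end_apply, hD.laplacian_apply (wspan_jet_le _ _ ha),
      add_sub_cancel_right, map_sum]
    refine Finset.sum_eq_zero fun μ _ => ?_
    rw [aeval_intertwine (S := wspan K deg (p, k, g)) (f := D μ)
      (fun x hx => hD.laplacian_mem_wspan hx) (fun x hx => hD.laplacian_comm hx μ) _
      (tau_mem μ (wspan_jet_le _ _ ha)), ih (by push_cast at hn; omega) (tau_mem_jet μ ha), map_zero]

/-- A monomial has a definite number of antifield derivatives, so a ladder polynomial kills it, and
the roots `(4 - p) k + j k` are positive integers. Sums of monomials are covered because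
`recoverable` is a subspace. -/
theorem IsTotalDeriv.mem_recoverable [CharZero K] (hD : IsTotalDeriv D) {p k g : ℤ} (hp : p < 4)
    (hk : 0 < k) {a : LocalForm K} (ha : a ∈ wspan K deg (p, k, g)) :
    a ∈ recoverable (laplacian D) := by
  refine (Submodule.span_le.2 ?_ : wspan K deg (p, k, g) ≤ _) ha
  rintro _ ⟨l, rfl, hl⟩
  have hm : ∃ n, (l.map gen).prod ∈ wspan K jetDeg ((p, k, g), n) := by
    refine ⟨(l.map jetDeg).sum.2, ?_⟩
    have : (l.map jetDeg).sum.1 = (p, k, g) := by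
      rw [← hl]
      exact (map_list_sum (AddMonoidHom.fst (ℤ × ℤ × ℤ) ℤ) _).trans (by simp [Function.comp_def, jetDeg])
    rw [← this]
    exact prod_mem_wspan jetDeg l
  obtain ⟨n, hn⟩ := hm
  refine mem_recoverable_of_aeval ?_ (hD.aeval_ladder (n.toNat + 1) (by push_cast; omega) hn)
  have := eval_ladder_ne_zero (K := K) (k := k) (c := (4 - p) * k) (fun j => ?_) (n.toNat + 1) 0
  · simpa using this
  · have h : (0 : ℤ) < (4 - p) * k + j * k := by
      have : 0 < 4 - p := by omega
      positivity
    exact_mod_cast h.ne'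

/-- The algebraic Poincaré lemma in positive antighost number, relative to a stable subspace. -/
theorem IsTotalDeriv.poincare [CharZero K] (hD : IsTotalDeriv D) {S : Submodule K (LocalForm K)}
    (hdx : ∀ μ, ∀ a ∈ S, gen (.dx μ) * a ∈ S) (hS : ∀ μ, ∀ a ∈ S, D μ a ∈ S)
    (hi : ∀ μ, ∀ a ∈ S, iota μ a ∈ S) (ht : ∀ μ, ∀ a ∈ S, tau μ a ∈ S)
    {p k g : ℤ} (hp : p < 4) (hk : 0 < k) {a : LocalForm K} (haS : a ∈ S)
    (ha : a ∈ wspan K deg (p, k, g)) (h : diff D a = 0) :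
    ∃ b ∈ S, b ∈ wspan K deg (p - 1, k, g) ∧ a = diff D b := by
  have hdS : ∀ a ∈ S, diff D a ∈ S := fun a ha => by
    rw [diff_apply]; exact sum_mem fun μ _ => hdx μ _ (hS μ a ha)
  have hhS : ∀ a ∈ S, homotopy a ∈ S := fun a ha => by
    rw [homotopy_apply]; exact sum_mem fun μ _ => ht μ _ (hi μ a ha)
  obtain ⟨Q, hQ⟩ := hD.mem_recoverable hp hk ha
  refine ⟨aeval (laplacian D) Q (homotopy a),
    aeval_apply_mem (fun x hx => add_mem (hdS _ (hhS _ hx)) (hhS _ (hdS _ hx))) Q (hhS _ haS),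
    aeval_apply_mem (fun x hx => hD.laplacian_mem_wspan hx) Q (homotopy_mem ha), ?_⟩
  -- As `diff D` squares to zero it commutes with the Laplacian, so `Q(L)` can be moved outside;
  -- then `a = Q(L) (L a)` with `L a = d (h a)`.
  rw [← aeval_intertwine (S := ⊤) (T' := laplacian D) (f := diff D) (fun x _ => trivial)
    (fun x _ => by simp [laplacian, hD.diff_diff]) Q trivial]
  conv_lhs => rw [← hQ]
  simp [laplacian, h]

end Poincare

/-! ### The two systems of total derivatives, and the relations of `γ` with `d` -/

section Instances

variable {K : Type*} [Field K]

/-- The Weyl relation `[∂/∂z_μ, z_ν] = δ_{μν}` on monomials `z^I`. Where the truncated subtraction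
is not an honest one, its coefficient vanishes. -/
theorem shift_lower (F : MultiIndex → LocalForm K) (μ ν : Fin 4) (I : MultiIndex) :
    (((I + Pi.single ν 1 : MultiIndex) μ : ℕ) : K) • F (I + Pi.single ν 1 - Pi.single μ 1) =
      (I μ : K) • F (I - Pi.single μ 1 + Pi.single ν 1) + if μ = ν then F I else 0 := by
  by_cases h : μ = ν
  · subst h
    have e1 : I + Pi.single μ 1 - Pi.single μ 1 = I := by ext x; simp
    by_cases h0 : I μ = 0
    · simp [e1, h0]
    · have e2 : I - Pi.single μ 1 + Pi.single μ 1 = I := by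
        ext x
        by_cases hx : x = μ
        · subst hx; simp only [Pi.add_apply, Pi.sub_apply, Pi.single_eq_same]; omega
        · simp [hx]
      simp [e1, e2, add_smul]
  · have e1 : I + Pi.single ν 1 - Pi.single μ 1 = I - Pi.single μ 1 + Pi.single ν 1 := by
      ext x
      by_cases hx : x = μ
      · subst hx; simp [h]
      · simp [hx]
    simp [e1, h]

theorem isTotalDeriv_totalDeriv : IsTotalDeriv (totalDeriv (K := K)) where
  isDer := totalDeriv_isDer
  dx μ ν := by rw [totalDeriv_gen]; rfl
  comm μ ν a := by
    simpa using (totalDeriv_isDer μ).comm_zero (totalDeriv_isDer ν) (fun x => by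
      cases x <;> simp [totalDeriv_gen, partialVal, add_right_comm]) a
  comm_iota μ ν a := by
    simpa using (iota_isDer μ).comm_zero (totalDeriv_isDer ν) (fun x => by
      cases x with
      | dx ρ =>
        simp only [totalDeriv_gen, partialVal, iota_gen, iotaVal, map_zero]
        split_ifs <;> simp [(totalDeriv_isDer ν).map_one]
      | _ => simp [totalDeriv_gen, partialVal, iota_gen, iotaVal]) a
  comm_tau μ ν a := by
    have hF : IsDer (0 + 0) (if μ = ν then antighDeriv (K := K) else 0) := by
      split_ifs
      · exact antighDeriv_isDer
      · exact isDer_zero _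
    have := (tau_isDer μ).comm_eq (totalDeriv_isDer ν) hF (fun x => by
      cases x with
      | psiStar ρ A I =>
        simp only [totalDeriv_gen, partialVal, tau_gen, tauVal, map_smul,
          shift_lower (fun I => gen (.psiStar ρ A I))]
        split_ifs <;> simp [antighDeriv_gen, Gen.antigh]
      -- The factor 2 in `tauVal` on `C*` is its antighost number, so that the commutator is exactly
      -- `antighDeriv`.
      | ghostStar A I =>
        simp only [totalDeriv_gen, partialVal, tau_gen, tauVal, map_smul, mul_smul,
          shift_lower (fun I => gen (.ghostStar A I))]
        split_ifs <;> simp [antighDeriv_gen, Gen.antigh]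
      | _ =>
        split_ifs <;>
          simp [totalDeriv_gen, partialVal, tau_gen, tauVal, antighDeriv_gen, Gen.antigh]) a
    split_ifs with h <;> simpa [h] using this
  mem μ w a ha := by
    have := (totalDeriv_isDer μ).mem_wspan (f := deg) (δ := 0) (fun x => ?_) ha
    · simpa using this
    · rw [totalDeriv_gen, add_zero]
      cases x <;> first | exact zero_mem _ | exact gen_mem_wspan_of_eq rfl

/-- Ignoring the ghosts breaks no commutation relation, since `tau`, `iota` and `antighDeriv` all
annihilate them. -/
theorem isTotalDeriv_barDeriv : IsTotalDeriv (barDeriv (K := K)) where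
  isDer := barDeriv_isDer
  dx μ ν := by rw [barDeriv_gen]; rfl
  comm μ ν a := by
    simpa using (barDeriv_isDer μ).comm_zero (barDeriv_isDer ν) (fun x => by
      cases x <;> simp [barDeriv_gen, barVal, partialVal, add_right_comm]) a
  comm_iota μ ν a := by
    simpa using (iota_isDer μ).comm_zero (barDeriv_isDer ν) (fun x => by
      cases x with
      | dx ρ =>
        simp only [barDeriv_gen, barVal, partialVal, iota_gen, iotaVal, map_zero]
        split_ifs <;> simp [(barDeriv_isDer ν).map_one]
      | _ => simp [barDeriv_gen, barVal, partialVal, iota_gen, iotaVal]) a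
  comm_tau μ ν a := by
    have hF : IsDer (0 + 0) (if μ = ν then antighDeriv (K := K) else 0) := by
      split_ifs
      · exact antighDeriv_isDer
      · exact isDer_zero _
    have := (tau_isDer μ).comm_eq (barDeriv_isDer ν) hF (fun x => by
      cases x with
      | psiStar ρ A I =>
        simp only [barDeriv_gen, barVal, partialVal, tau_gen, tauVal, map_smul,
          shift_lower (fun I => gen (.psiStar ρ A I))]
        split_ifs <;> simp [antighDeriv_gen, Gen.antigh]
      | ghostStar A I =>
        simp only [barDeriv_gen, barVal, partialVal, tau_gen, tauVal, map_smul, mul_smul,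
          shift_lower (fun I => gen (.ghostStar A I))]
        split_ifs <;> simp [antighDeriv_gen, Gen.antigh]
      | _ =>
        split_ifs <;>
          simp [barDeriv_gen, barVal, partialVal, tau_gen, tauVal, antighDeriv_gen, Gen.antigh]) a
    split_ifs with h <;> simpa [h] using this
  mem μ w a ha := by
    have := (barDeriv_isDer μ).mem_wspan (f := deg) (δ := 0) (fun x => ?_) ha
    · simpa using this
    · rw [barDeriv_gen, add_zero]
      cases x <;> first | exact zero_mem _ | exact gen_mem_wspan_of_eq rfl

theorem d_eq_diff : d (K := K) = diff totalDeriv := rfl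

theorem d_isDer : IsDer 1 (d (K := K)) := isDer_sum fun μ => (totalDeriv_isDer μ).dx_mul μ

theorem gamma_gamma (a : LocalForm K) [CharZero K] : gamma (gamma a) = 0 := by
  have h := gamma_isDer.comm_zero gamma_isDer (fun x => by
    cases x <;> simp [gamma_gen, gammaVal]) a
  have h2 : (2 : K) • gamma (gamma a) = 0 := by
    rw [two_smul]
    nth_rewrite 1 [h]
    simp
  exact (smul_eq_zero.1 h2).resolve_left two_ne_zero

theorem gamma_d (a : LocalForm K) : gamma (d a) = -d (gamma a) := by
  have h := gamma_isDer.comm_zero d_isDer (fun x => by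
    simp only [d_eq_diff, diff_apply, map_sum, gamma_isDer.mul, gamma_gen, gammaVal, totalDeriv_gen,
      twist_gen, Gen.parity, smul_mul_assoc]
    cases x <;> simp [partialVal, gamma_gen, gammaVal, totalDeriv_gen, add_right_comm]) a
  simpa using h

theorem gamma_mem {p k g : ℤ} {a : LocalForm K} (ha : a ∈ wspan K deg (p, k, g)) :
    gamma a ∈ wspan K deg (p, k, g + 1) := by
  have := gamma_isDer.mem_wspan (f := deg) (δ := (0, 0, 1)) (fun x => ?_) ha
  · simpa using this
  · rw [gamma_gen]
    cases x <;> first | exact zero_mem _ | exact gen_mem_wspan_of_eq rfl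

end Instances

/-! ### Invariant polynomials, and part (1) -/

section Invariants

variable {K : Type*} [Field K]

variable (K) in
/-- The polynomials in the invariants and the undifferentiated ghosts. -/
noncomputable def ghostInvariants : Subalgebra K (LocalForm K) :=
  Algebra.adjoin K
    (({m | ∃ μ, m = gen (.dx μ)} ∪ {m | ∃ μ α A I, m = fieldStrength μ α A I} ∪
      {m | ∃ μ A I, m = gen (.psiStar μ A I)} ∪ {m | ∃ A I, m = gen (.ghostStar A I)}) ∪
      {m | ∃ A, m = gen (.ghost A 0)})

/-- The subalgebras of invariant polynomials, without and with undifferentiated ghosts, are both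
preserved by a derivation as soon as it maps the generators into invariant polynomials. -/
theorem mem_invariantPolynomials_of_isDer {s : ℕ} {D : LocalForm K →ₗ[K] LocalForm K}
    (hD : IsDer s D) (h1 : ∀ μ, D (gen (.dx μ)) ∈ invariantPolynomials K)
    (h2 : ∀ μ α A I, D (fieldStrength μ α A I) ∈ invariantPolynomials K)
    (h3 : ∀ μ A I, D (gen (.psiStar μ A I)) ∈ invariantPolynomials K)
    (h4 : ∀ A I, D (gen (.ghostStar A I)) ∈ invariantPolynomials K) :
    (∀ a ∈ invariantPolynomials K, D a ∈ invariantPolynomials K) ∧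
    ((∀ A, D (gen (.ghost A 0)) = 0) → ∀ a ∈ ghostInvariants K, D a ∈ ghostInvariants K) := by
  have hle : invariantPolynomials K ≤ ghostInvariants K :=
    Algebra.adjoin_mono Set.subset_union_left
  have hsmul : ∀ {S : Set (LocalForm K)} (x : Gen), (gen x : LocalForm K) ∈ S →
      twist s (gen x : LocalForm K) ∈ Algebra.adjoin K S := fun x hx => by
      rw [twist_gen]; exact Subalgebra.smul_mem _ (Algebra.subset_adjoin hx) _
  have hF : ∀ {S : Set (LocalForm K)} (μ α A : Fin 4) (I : MultiIndex),
      (fieldStrength μ α A I : LocalForm K) ∈ S →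
      twist s (fieldStrength μ α A I : LocalForm K) ∈ Algebra.adjoin K S := fun μ α A I hx => by
    have : twist s (fieldStrength μ α A I : LocalForm K) =
        (-1 : K) ^ s • fieldStrength μ α A I := by
      simp only [fieldStrength, map_smul, map_sub, twist_gen, Gen.parity, mul_one, ← smul_sub]
      rw [smul_comm]
    rw [this]; exact Subalgebra.smul_mem _ (Algebra.subset_adjoin hx) _
  refine ⟨fun a ha => hD.mem_adjoin ?_ ?_ ha, fun h5 a ha => hD.mem_adjoin ?_ ?_ ha⟩
  · rintro x (((⟨μ, rfl⟩ | ⟨μ, α, A, I, rfl⟩) | ⟨μ, A, I, rfl⟩) | ⟨A, I, rfl⟩)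
    · exact hsmul _ (Or.inl (Or.inl (Or.inl ⟨μ, rfl⟩)))
    · exact hF _ _ _ _ (Or.inl (Or.inl (Or.inr ⟨μ, α, A, I, rfl⟩)))
    · exact hsmul _ (Or.inl (Or.inr ⟨μ, A, I, rfl⟩))
    · exact hsmul _ (Or.inr ⟨A, I, rfl⟩)
  · rintro x (((⟨μ, rfl⟩ | ⟨μ, α, A, I, rfl⟩) | ⟨μ, A, I, rfl⟩) | ⟨A, I, rfl⟩)
    exacts [h1 _, h2 _ _ _ _, h3 _ _ _, h4 _ _]
  · rintro x ((((⟨μ, rfl⟩ | ⟨μ, α, A, I, rfl⟩) | ⟨μ, A, I, rfl⟩) | ⟨A, I, rfl⟩) | ⟨A, rfl⟩)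
    · exact hsmul _ (Or.inl (Or.inl (Or.inl (Or.inl ⟨μ, rfl⟩))))
    · exact hF _ _ _ _ (Or.inl (Or.inl (Or.inl (Or.inr ⟨μ, α, A, I, rfl⟩))))
    · exact hsmul _ (Or.inl (Or.inl (Or.inr ⟨μ, A, I, rfl⟩)))
    · exact hsmul _ (Or.inl (Or.inr ⟨A, I, rfl⟩))
    · exact hsmul _ (Or.inr ⟨A, rfl⟩)
  · rintro x ((((⟨μ, rfl⟩ | ⟨μ, α, A, I, rfl⟩) | ⟨μ, A, I, rfl⟩) | ⟨A, I, rfl⟩) | ⟨A, rfl⟩)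
    exacts [hle (h1 _), hle (h2 _ _ _ _), hle (h3 _ _ _), hle (h4 _ _),
      (h5 A).symm ▸ zero_mem (ghostInvariants K)]

theorem dx_mem_inv (μ : Fin 4) : (gen (.dx μ) : LocalForm K) ∈ invariantPolynomials K :=
  Algebra.subset_adjoin (Or.inl (Or.inl (Or.inl ⟨μ, rfl⟩)))
theorem fieldStrength_mem_inv (μ α A : Fin 4) (I : MultiIndex) :
    (fieldStrength μ α A I : LocalForm K) ∈ invariantPolynomials K :=
  Algebra.subset_adjoin (Or.inl (Or.inl (Or.inr ⟨μ, α, A, I, rfl⟩)))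
theorem psiStar_mem_inv (μ A : Fin 4) (I : MultiIndex) :
    (gen (.psiStar μ A I) : LocalForm K) ∈ invariantPolynomials K :=
  Algebra.subset_adjoin (Or.inl (Or.inr ⟨μ, A, I, rfl⟩))
theorem ghostStar_mem_inv (A : Fin 4) (I : MultiIndex) :
    (gen (.ghostStar A I) : LocalForm K) ∈ invariantPolynomials K :=
  Algebra.subset_adjoin (Or.inr ⟨A, I, rfl⟩)
theorem inv_le_ghostInvariants : invariantPolynomials K ≤ ghostInvariants K :=
  Algebra.adjoin_mono Set.subset_union_left

theorem iota_stable (μ : Fin 4) :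
    (∀ a ∈ invariantPolynomials K, iota μ a ∈ invariantPolynomials K) ∧
    (∀ a ∈ ghostInvariants K, iota μ a ∈ ghostInvariants K) := by
  have h := mem_invariantPolynomials_of_isDer (iota_isDer (K := K) μ)
    (fun ν => by
      rw [iota_gen, iotaVal]
      split_ifs
      · exact one_mem _
      · exact zero_mem _)
    (fun ν α A I => by simp [fieldStrength, iota_gen, iotaVal])
    (fun ν A I => by simp [iota_gen, iotaVal]) (fun A I => by simp [iota_gen, iotaVal])
  exact ⟨h.1, h.2 fun A => by simp [iota_gen, iotaVal]⟩

/-- Lowering derivatives of `ψ` would not preserve field strengths; `tau` annihilates `ψ`, which is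
why the homotopy uses the antifields only. -/
theorem tau_stable (μ : Fin 4) :
    (∀ a ∈ invariantPolynomials K, tau μ a ∈ invariantPolynomials K) ∧
    (∀ a ∈ ghostInvariants K, tau μ a ∈ ghostInvariants K) := by
  have h := mem_invariantPolynomials_of_isDer (tau_isDer (K := K) μ)
    (fun ν => by simp [tau_gen, tauVal])
    (fun ν α A I => by simp [fieldStrength, tau_gen, tauVal])
    (fun ν A I => by
      rw [tau_gen]; exact Subalgebra.smul_mem _ (psiStar_mem_inv _ _ _) _)
    (fun A I => by
      rw [tau_gen]; exact Subalgebra.smul_mem _ (ghostStar_mem_inv _ _) _)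
  exact ⟨h.1, h.2 fun A => by simp [tau_gen, tauVal]⟩

theorem barDeriv_fieldStrength (μ ν α A : Fin 4) (I : MultiIndex) :
    barDeriv μ (fieldStrength ν α A I : LocalForm K) = fieldStrength ν α A (I + Pi.single μ 1) := by
  simp [fieldStrength, barDeriv_gen, barVal, partialVal, add_right_comm]

theorem totalDeriv_fieldStrength (μ ν α A : Fin 4) (I : MultiIndex) :
    totalDeriv μ (fieldStrength ν α A I : LocalForm K) =
      fieldStrength ν α A (I + Pi.single μ 1) := by
  simp [fieldStrength, totalDeriv_gen, partialVal, add_right_comm]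

theorem barDeriv_stable (μ : Fin 4) :
    (∀ a ∈ invariantPolynomials K, barDeriv μ a ∈ invariantPolynomials K) ∧
    (∀ a ∈ ghostInvariants K, barDeriv μ a ∈ ghostInvariants K) := by
  have h := mem_invariantPolynomials_of_isDer (barDeriv_isDer (K := K) μ)
    (fun ν => by simp [barDeriv_gen, barVal, partialVal])
    (fun ν α A I => by rw [barDeriv_fieldStrength]; exact fieldStrength_mem_inv _ _ _ _)
    (fun ν A I => by rw [barDeriv_gen]; exact psiStar_mem_inv _ _ _)
    (fun A I => by rw [barDeriv_gen]; exact ghostStar_mem_inv _ _)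
  exact ⟨h.1, h.2 fun A => by simp [barDeriv_gen, barVal]⟩

theorem totalDeriv_eq_barDeriv (μ : Fin 4) {a : LocalForm K} (ha : a ∈ invariantPolynomials K) :
    totalDeriv μ a = barDeriv μ a := by
  refine (totalDeriv_isDer μ).eqOn_adjoin (barDeriv_isDer μ) ?_ ha
  rintro x (((⟨μ, rfl⟩ | ⟨μ, α, A, I, rfl⟩) | ⟨μ, A, I, rfl⟩) | ⟨A, I, rfl⟩)
  · simp [totalDeriv_gen, barDeriv_gen, barVal]
  · rw [totalDeriv_fieldStrength, barDeriv_fieldStrength]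
  · simp [totalDeriv_gen, barDeriv_gen, barVal]
  · simp [totalDeriv_gen, barDeriv_gen, barVal]

theorem invariant_poincare [CharZero K] {p k : ℤ} (hp : p < 4) (hk : 0 < k) {a : LocalForm K}
    (haS : a ∈ invariantPolynomials K) (ha : a ∈ homogeneous K p k 0) (h : d a = 0) :
    ∃ b ∈ invariantPolynomials K, b ∈ homogeneous K (p - 1) k 0 ∧ a = d b := by
  rw [homogeneous_eq] at ha ⊢
  rw [d_eq_diff] at h ⊢
  exact isTotalDeriv_totalDeriv.poincare (S := Subalgebra.toSubmodule (invariantPolynomials K))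
    (fun μ a ha => Subalgebra.mul_mem _ (dx_mem_inv μ) ha)
    (fun μ a ha => by rw [totalDeriv_eq_barDeriv μ ha]; exact (barDeriv_stable μ).1 a ha)
    (fun μ => (iota_stable μ).1) (fun μ => (tau_stable μ).1) hp hk haS ha h

end Invariants


/-! ### The cohomology of `γ` -/

section GammaCohomology

variable {K : Type*} [Field K]

theorem lower_raise {I : MultiIndex} {ν : Fin 4} (h : I ν ≠ 0) :
    I - Pi.single ν 1 + Pi.single ν 1 = I := by
  ext x
  by_cases hx : x = ν
  · subst hx; simp only [Pi.add_apply, Pi.sub_apply, Pi.single_eq_same]; omega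
  · simp [hx]

variable (K) in
/-- The number of derivatives in `∂_I`. -/
def order (I : MultiIndex) : K := ∑ ν, (I ν : K)

theorem order_ne_zero [CharZero K] {I : MultiIndex} (h : I ≠ 0) : order K I ≠ 0 := by
  obtain ⟨ν, hν⟩ := Function.ne_iff.1 h
  have : (∑ ν, I ν) ≠ 0 := fun h0 => hν (Finset.sum_eq_zero_iff.1 h0 ν (Finset.mem_univ _))
  rw [order, ← Nat.cast_sum]
  exact_mod_cast this

/-- The symmetrized derivative of the gravitino whose image under `γ` is `∂_I C`. -/
noncomputable def symPsi (A : Fin 4) (I : MultiIndex) : LocalForm K :=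
  ∑ ν, ((I ν : K) / order K I) • gen (.psi ν A (I - Pi.single ν 1))

/-- Values of the contracting homotopy for `γ`. -/
noncomputable def contractVal : Gen → LocalForm K
  | .ghost A I => symPsi A I
  | _ => 0

theorem contractVal_parity : HasParity 1 (contractVal (K := K)) := by
  intro x
  cases x with
  | ghost A I =>
    simp only [contractVal, symPsi, map_sum, map_smul, twist_gen, Finset.smul_sum]
    refine Finset.sum_congr rfl fun ν _ => ?_
    rw [smul_comm]
    rfl
  | _ => simp [contractVal]

/-- The contracting homotopy for `γ`, an odd derivation. -/
noncomputable def contract : LocalForm K →ₗ[K] LocalForm K :=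
  deriv 1 contractVal contractVal_parity

theorem contract_isDer : IsDer 1 (contract (K := K)) := isDer_deriv _ _ _
theorem contract_gen (x : Gen) : contract (gen x : LocalForm K) = contractVal x :=
  deriv_gen _ _ _ _

/-- The anticommutator of `γ` and its contracting homotopy. -/
noncomputable def gammaLaplacian : Module.End K (LocalForm K) :=
  gamma ∘ₗ contract + contract ∘ₗ gamma

theorem gammaLaplacian_apply (a : LocalForm K) :
    gammaLaplacian a = gamma (contract a) + contract (gamma a) := rfl

theorem IsDer.anticomm {D E : LocalForm K →ₗ[K] LocalForm K} (hD : IsDer 1 D) (hE : IsDer 1 E) :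
    IsDer 0 (D ∘ₗ E + E ∘ₗ D) := by
  have e : D ∘ₗ E + E ∘ₗ D = D ∘ₗ E - (-1 : K) ^ (1 * 1) • E ∘ₗ D :=
    LinearMap.ext fun a => by simp
  rw [e]
  exact (hD.comm hE).of_two

theorem gammaLaplacian_isDer : IsDer 0 (gammaLaplacian (K := K)) :=
  gamma_isDer.anticomm contract_isDer

theorem gammaLaplacian_gamma [CharZero K] (a : LocalForm K) :
    gammaLaplacian (gamma a) = gamma (gammaLaplacian a) := by
  simp [gammaLaplacian_apply, gamma_gamma]

theorem gamma_symPsi [CharZero K] (A : Fin 4) {I : MultiIndex} (hI : I ≠ 0) :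
    gamma (symPsi A I : LocalForm K) = gen (.ghost A I) := by
  have h : ∀ ν, gamma (((I ν : K) / order K I) • gen (.psi ν A (I - Pi.single ν 1)) : LocalForm K)
      = ((I ν : K) / order K I) • gen (.ghost A I) := by
    intro ν
    by_cases h0 : I ν = 0
    · simp [h0]
    · rw [map_smul, gamma_gen, gammaVal, lower_raise h0]
  rw [symPsi, map_sum, Finset.sum_congr rfl fun ν _ => h ν, ← Finset.sum_smul, ← Finset.sum_div,
    ← order, div_self (order_ne_zero hI), one_smul]

theorem contract_symPsi (A : Fin 4) (I : MultiIndex) :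
    contract (symPsi A I : LocalForm K) = 0 := by
  simp [symPsi, contract_gen, contractVal]

theorem gammaLaplacian_ghost [CharZero K] (A : Fin 4) {I : MultiIndex} (hI : I ≠ 0) :
    gammaLaplacian (gen (.ghost A I) : LocalForm K) = gen (.ghost A I) := by
  rw [gammaLaplacian_apply, contract_gen, contractVal, gamma_symPsi A hI, gamma_gen, gammaVal,
    map_zero, add_zero]

theorem gammaLaplacian_symPsi [CharZero K] (A : Fin 4) {I : MultiIndex} (hI : I ≠ 0) :
    gammaLaplacian (symPsi A I : LocalForm K) = symPsi A I := by
  rw [gammaLaplacian_apply, contract_symPsi, map_zero, zero_add, gamma_symPsi A hI, contract_gen,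
    contractVal]

theorem gamma_fieldStrength (μ α A : Fin 4) (I : MultiIndex) :
    gamma (fieldStrength μ α A I : LocalForm K) = 0 := by
  simp [fieldStrength, gamma_gen, gammaVal, add_right_comm]

theorem contract_fieldStrength (μ α A : Fin 4) (I : MultiIndex) :
    contract (fieldStrength μ α A I : LocalForm K) = 0 := by
  simp [fieldStrength, contract_gen, contractVal]

/-- Up to field strengths, all derivatives of the gravitino are symmetrized ones. -/
theorem psi_sub_symPsi_mem [CharZero K] (μ A : Fin 4) (I : MultiIndex) :
    (gen (.psi μ A I) - symPsi A (I + Pi.single μ 1) : LocalForm K) ∈ invariantPolynomials K := by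
  set J : MultiIndex := I + Pi.single μ 1 with hJ
  have hJ0 : J ≠ 0 := fun h => by
    have := congrFun h μ
    simp [hJ] at this
  -- The weights `J ν / |J|` sum to 1. Comparing with `symPsi` term by term, each difference
  -- exchanges `μ` with a derivative index and is twice a field strength.
  have e : (gen (.psi μ A I) : LocalForm K) = ∑ ν, ((J ν : K) / order K J) • gen (.psi μ A I) := by
    rw [← Finset.sum_smul, ← Finset.sum_div, ← order, div_self (order_ne_zero hJ0), one_smul]
  rw [e, symPsi, ← Finset.sum_sub_distrib]
  refine Subalgebra.sum_mem _ fun ν _ => ?_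
  rw [← smul_sub]
  by_cases h0 : J ν = 0
  · simp [h0]
  refine Subalgebra.smul_mem _ ?_ _
  by_cases hν : ν = μ
  · subst hν
    have : J - Pi.single ν 1 = I := by ext x; simp [hJ]
    simp [this]
  · have hI : I ν ≠ 0 := by simpa [hJ, hν] using h0
    have e1 : J - Pi.single ν 1 = I - Pi.single ν 1 + Pi.single μ 1 := by
      ext x
      by_cases hx : x = ν
      · subst hx; simp [hJ, hν]
      · simp [hJ, hx]
    have e2 : (gen (.psi μ A I) - gen (.psi ν A (J - Pi.single ν 1)) : LocalForm K) =
        (2 : K) • fieldStrength μ ν A (I - Pi.single ν 1) := by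
      rw [fieldStrength, smul_smul, mul_inv_cancel₀ two_ne_zero, one_smul, lower_raise hI, e1]
    rw [e2]
    exact Subalgebra.smul_mem _ (fieldStrength_mem_inv _ _ _ _) _

theorem gamma_ghostInvariants {a : LocalForm K} (ha : a ∈ ghostInvariants K) : gamma a = 0 := by
  refine gamma_isDer.eqOn_adjoin (isDer_zero 1) ?_ ha
  rintro x ((((⟨μ, rfl⟩ | ⟨μ, α, A, I, rfl⟩) | ⟨μ, A, I, rfl⟩) | ⟨A, I, rfl⟩) | ⟨A, rfl⟩)
  · simp [gamma_gen, gammaVal]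
  · simp [gamma_fieldStrength]
  · simp [gamma_gen, gammaVal]
  · simp [gamma_gen, gammaVal]
  · simp [gamma_gen, gammaVal]

theorem gammaLaplacian_ghostInvariants {a : LocalForm K} (ha : a ∈ ghostInvariants K) :
    gammaLaplacian a = 0 := by
  refine gammaLaplacian_isDer.eqOn_adjoin (isDer_zero 0) ?_ ha
  rintro x ((((⟨μ, rfl⟩ | ⟨μ, α, A, I, rfl⟩) | ⟨μ, A, I, rfl⟩) | ⟨A, I, rfl⟩) | ⟨A, rfl⟩)
  · simp [gammaLaplacian_apply, contract_gen, contractVal, gamma_gen, gammaVal]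
  · simp [gammaLaplacian_apply, gamma_fieldStrength, contract_fieldStrength]
  · simp [gammaLaplacian_apply, contract_gen, contractVal, gamma_gen, gammaVal]
  · simp [gammaLaplacian_apply, contract_gen, contractVal, gamma_gen, gammaVal]
  -- At `I = 0` all coefficients of `symPsi` vanish, so `contract` kills the undifferentiated
  -- ghosts.
  · simp [gammaLaplacian_apply, contract_gen, contractVal, gamma_gen, gammaVal, symPsi]

variable (K) in
/-- The span of the eigenvectors of `gammaLaplacian` with positive eigenvalue. -/
noncomputable def positivePart : Submodule K (LocalForm K) :=
  Submodule.span K {v | ∃ n : ℕ, 0 < n ∧ gammaLaplacian v = (n : K) • v}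

theorem mul_mem_positivePart {a v : LocalForm K} (ha : a ∈ ghostInvariants K)
    (hv : v ∈ positivePart K) : a * v ∈ positivePart K ∧ v * a ∈ positivePart K := by
  induction hv using Submodule.span_induction with
  | mem v hv =>
    obtain ⟨n, hn, hv⟩ := hv
    constructor <;> refine Submodule.subset_span ⟨n, hn, ?_⟩ <;>
      simp [gammaLaplacian_isDer.mul, gammaLaplacian_ghostInvariants ha, hv, twist_zero]
  | zero => simp
  | add v w _ _ h1 h2 =>
    rw [mul_add, add_mul]; exact ⟨add_mem h1.1 h2.1, add_mem h1.2 h2.2⟩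
  | smul r v _ h =>
    rw [mul_smul_comm, smul_mul_assoc]
    exact ⟨Submodule.smul_mem _ _ h.1, Submodule.smul_mem _ _ h.2⟩

theorem positivePart_mul {v w : LocalForm K} (hv : v ∈ positivePart K)
    (hw : w ∈ positivePart K) : v * w ∈ positivePart K := by
  induction hv using Submodule.span_induction with
  | mem v hv =>
    obtain ⟨n, hn, hv⟩ := hv
    induction hw using Submodule.span_induction with
    | mem w hw =>
      obtain ⟨m, -, hw⟩ := hw
      refine Submodule.subset_span ⟨n + m, by omega, ?_⟩
      simp [gammaLaplacian_isDer.mul, hv, hw, twist_zero, add_smul]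
    | zero => simp
    | add w w' _ _ h1 h2 => rw [mul_add]; exact add_mem h1 h2
    | smul r w _ h => rw [mul_smul_comm]; exact Submodule.smul_mem _ _ h
  | zero => simp
  | add v v' _ _ h1 h2 => rw [add_mul]; exact add_mem h1 h2
  | smul r v _ h => rw [smul_mul_assoc]; exact Submodule.smul_mem _ _ h

theorem mem_positivePart_of_eq {v : LocalForm K} (h : gammaLaplacian v = v) :
    v ∈ positivePart K :=
  Submodule.subset_span ⟨1, one_pos, by simpa using h⟩

/-- Every generator is a sum of a ghost invariant (eigenvalue 0) and an eigenvector of eigenvalue 1,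
namely `symPsi` or a differentiated ghost. Eigenvalues add under products, so any product with a
positive factor stays in the positive part. -/
theorem exists_ghostInvariants_add [CharZero K] (a : LocalForm K) :
    ∃ β ∈ ghostInvariants K, ∃ v ∈ positivePart K, a = β + v := by
  have inv : ∀ x ∈ invariantPolynomials K,
      ∃ β ∈ ghostInvariants K, ∃ v ∈ positivePart K, x = β + v := fun x hx =>
    ⟨x, inv_le_ghostInvariants hx, 0, zero_mem _, (add_zero x).symm⟩
  induction a using induction_on with
  | hc r => exact ⟨_, Subalgebra.algebraMap_mem _ r, 0, zero_mem _, (add_zero _).symm⟩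
  | hg x =>
    cases x with
    | dx μ => exact inv _ (dx_mem_inv μ)
    | psi μ A I =>
      refine ⟨_, inv_le_ghostInvariants (psi_sub_symPsi_mem μ A I), symPsi A (I + Pi.single μ 1),
        mem_positivePart_of_eq (gammaLaplacian_symPsi A fun h => ?_), (sub_add_cancel _ _).symm⟩
      have := congrFun h μ
      simp at this
    | ghost A I =>
      by_cases hI : I = 0
      · subst hI
        exact ⟨_, Algebra.subset_adjoin (Or.inr ⟨A, rfl⟩), 0, zero_mem _, (add_zero _).symm⟩
      · exact ⟨0, zero_mem _, _, mem_positivePart_of_eq (gammaLaplacian_ghost A hI),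
          (zero_add _).symm⟩
    | psiStar μ A I => exact inv _ (psiStar_mem_inv μ A I)
    | ghostStar A I => exact inv _ (ghostStar_mem_inv A I)
  | hm a b h1 h2 =>
    obtain ⟨β, hβ, v, hv, rfl⟩ := h1
    obtain ⟨β', hβ', v', hv', rfl⟩ := h2
    refine ⟨β * β', mul_mem hβ hβ', β * v' + v * β' + v * v',
      add_mem (add_mem (mul_mem_positivePart hβ hv').1 (mul_mem_positivePart hβ' hv).2)
        (positivePart_mul hv hv'), ?_⟩
    rw [add_mul, mul_add, mul_add]
    abel
  | ha a b h1 h2 =>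
    obtain ⟨β, hβ, v, hv, rfl⟩ := h1
    obtain ⟨β', hβ', v', hv', rfl⟩ := h2
    exact ⟨β + β', add_mem hβ hβ', v + v', add_mem hv hv', by abel⟩

theorem positivePart_le_recoverable [CharZero K] :
    positivePart K ≤ recoverable (gammaLaplacian (K := K)) := by
  refine Submodule.span_le.2 ?_
  rintro v ⟨n, hn, hv⟩
  refine mem_recoverable_of_aeval (P := X - C (n : K)) ?_ ?_
  · simpa using hn.ne'
  · rw [map_sub, aeval_X, aeval_C, LinearMap.sub_apply, hv, Module.algebraMap_end_apply, sub_self]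

/-- The positive part `v` of `b` is also closed, so its Laplacian is `γ (contract v)`; inverting the
Laplacian, which commutes with `γ`, shows that `v` is exact. -/
theorem exists_of_gamma_eq_zero [CharZero K] {b : LocalForm K} (hb : gamma b = 0) :
    ∃ β ∈ ghostInvariants K, ∃ e, b = β + gamma e := by
  obtain ⟨β, hβ, v, hv, rfl⟩ := exists_ghostInvariants_add b
  rw [map_add, gamma_ghostInvariants hβ, zero_add] at hb
  obtain ⟨Q, hQ⟩ := positivePart_le_recoverable hv
  refine ⟨β, hβ, aeval gammaLaplacian Q (contract v), ?_⟩
  rw [gammaLaplacian_apply, hb, map_zero, add_zero, aeval_intertwine (S := ⊤) (f := gamma)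
    (T := gammaLaplacian) (fun _ _ => trivial) (fun x _ => gammaLaplacian_gamma x) Q trivial] at hQ
  rw [hQ]

/-- Only the positive part `v` of `e` contributes to `γ e`. Since `v = Q(L) (L v)`, one gets `β = γ
v = Q(L) (L β)`, and `L β = 0`. -/
theorem eq_zero_of_eq_gamma [CharZero K] {β e : LocalForm K} (hβ : β ∈ ghostInvariants K)
    (he : β = gamma e) : β = 0 := by
  obtain ⟨β', hβ', v, hv, rfl⟩ := exists_ghostInvariants_add e
  rw [map_add, gamma_ghostInvariants hβ', zero_add] at he
  obtain ⟨Q, hQ⟩ := positivePart_le_recoverable hv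
  rw [he, ← hQ, ← aeval_intertwine (S := ⊤) (f := gamma)
    (T := gammaLaplacian) (fun _ _ => trivial) (fun x _ => gammaLaplacian_gamma x) Q trivial,
    ← gammaLaplacian_gamma, ← he, gammaLaplacian_ghostInvariants hβ, map_zero]

/-- Values of the odd derivation replacing ghosts by the component `ψ_μ` of the gravitino. -/
noncomputable def ghostToPsiVal (μ : Fin 4) : Gen → LocalForm K
  | .ghost A I => gen (.psi μ A I)
  | _ => 0

theorem ghostToPsiVal_parity (μ : Fin 4) : HasParity 1 (ghostToPsiVal (K := K) μ) := by
  intro x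
  cases x <;> simp [ghostToPsiVal, twist_gen, Gen.parity]

/-- The odd derivation replacing ghosts by the component `ψ_μ` of the gravitino. -/
noncomputable def ghostToPsi (μ : Fin 4) : LocalForm K →ₗ[K] LocalForm K :=
  deriv 1 (ghostToPsiVal μ) (ghostToPsiVal_parity μ)

theorem ghostToPsi_isDer (μ : Fin 4) : IsDer 1 (ghostToPsi (K := K) μ) := isDer_deriv _ _ _
theorem ghostToPsi_gen (μ : Fin 4) (x : Gen) :
    ghostToPsi μ (gen x : LocalForm K) = ghostToPsiVal μ x := deriv_gen _ _ _ _

/-- On ghost invariants `∂_μ` is `barDeriv μ` plus the anticommutator of `γ` and `ghostToPsi μ`: on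
`C` this is `∂_μ C = γ ψ_μ`, and on the other generators the anticommutator vanishes. Half of it
drops out as `γ a = 0`. -/
theorem totalDeriv_ghostInvariants (μ : Fin 4) {a : LocalForm K} (ha : a ∈ ghostInvariants K) :
    totalDeriv μ a = barDeriv μ a + gamma (ghostToPsi μ a) := by
  have h := (totalDeriv_isDer μ).eqOn_adjoin
    ((barDeriv_isDer μ).add (gamma_isDer.anticomm (ghostToPsi_isDer μ))) ?_ ha
  · simpa [gamma_ghostInvariants ha] using h
  rintro x ((((⟨ν, rfl⟩ | ⟨ν, α, A, I, rfl⟩) | ⟨ν, A, I, rfl⟩) | ⟨A, I, rfl⟩) | ⟨A, rfl⟩)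
  · simp [totalDeriv_gen, barDeriv_gen, barVal, ghostToPsi_gen, ghostToPsiVal, gamma_gen, gammaVal]
  · have : ghostToPsi μ (fieldStrength ν α A I : LocalForm K) = 0 := by
      simp [fieldStrength, ghostToPsi_gen, ghostToPsiVal]
    simp [totalDeriv_fieldStrength, barDeriv_fieldStrength, gamma_fieldStrength, this]
  · simp [totalDeriv_gen, barDeriv_gen, barVal, ghostToPsi_gen, ghostToPsiVal, gamma_gen, gammaVal]
  · simp [totalDeriv_gen, barDeriv_gen, barVal, ghostToPsi_gen, ghostToPsiVal, gamma_gen, gammaVal]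
  · simp [totalDeriv_gen, barDeriv_gen, barVal, ghostToPsi_gen, ghostToPsiVal, gamma_gen, gammaVal,
      partialVal]

theorem exists_d_eq_diff_barDeriv {a : LocalForm K} (ha : a ∈ ghostInvariants K) :
    ∃ x, d a = diff barDeriv a + gamma x := by
  refine ⟨-∑ μ, gen (.dx μ) * ghostToPsi μ a, ?_⟩
  simp only [d_eq_diff, diff_apply, map_neg, map_sum, gamma_isDer.mul, gamma_gen, gammaVal, zero_mul,
    zero_add, twist_gen, Gen.parity, totalDeriv_ghostInvariants _ ha, mul_add,
    Finset.sum_add_distrib]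
  simp

theorem proj_mem_ghostInvariants (w : ℤ × ℤ × ℤ) {a : LocalForm K} (ha : a ∈ ghostInvariants K) :
    proj deg w a ∈ ghostInvariants K := by
  refine proj_mem_adjoin ?_ w ha
  rintro x ((((⟨μ, rfl⟩ | ⟨μ, α, A, I, rfl⟩) | ⟨μ, A, I, rfl⟩) | ⟨A, I, rfl⟩) | ⟨A, rfl⟩)
  · exact ⟨_, gen_mem_wspan _ _⟩
  · exact ⟨(0, 0, 0), Submodule.smul_mem _ _
      (sub_mem (gen_mem_wspan_of_eq rfl) (gen_mem_wspan_of_eq rfl))⟩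
  · exact ⟨_, gen_mem_wspan _ _⟩
  · exact ⟨_, gen_mem_wspan _ _⟩
  · exact ⟨_, gen_mem_wspan _ _⟩

end GammaCohomology

/-! ### Vanishing outside form degrees 0 to 4 -/

section FormDegree

variable {K : Type*} [Field K]

theorem eq_zero_of_formDeg_neg {p k g : ℤ} (hp : p < 0) {a : LocalForm K}
    (ha : a ∈ wspan K deg (p, k, g)) : a = 0 := by
  rw [← homogeneous_eq] at ha
  have : homogeneous K p k g = ⊥ := by
    refine Submodule.span_eq_bot.2 ?_
    rintro _ ⟨l, -, hl, -⟩
    have : 0 ≤ (l.map Gen.formDeg).sum := by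
      refine List.sum_nonneg fun y hy => ?_
      obtain ⟨x, -, rfl⟩ := List.mem_map.1 hy
      cases x <;> simp [Gen.formDeg]
    omega
  rwa [this] at ha

/-- The index of a differential. -/
def dxIndex : Gen → Option (Fin 4)
  | .dx μ => some μ
  | _ => none

theorem dx_mul_prod_eq_zero [CharZero K] {μ : Fin 4} {l : List Gen}
    (h : μ ∈ l.filterMap dxIndex) : (gen (.dx μ) * (l.map gen).prod : LocalForm K) = 0 := by
  have hsq : (gen (.dx μ) * gen (.dx μ) : LocalForm K) = 0 := by
    have h1 := gen_mul_gen (K := K) (.dx μ) (.dx μ)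
    have h2 : (2 : K) • (gen (.dx μ) * gen (.dx μ) : LocalForm K) = 0 := by
      rw [two_smul]
      nth_rewrite 1 [h1]
      simp [Gen.parity]
    exact (smul_eq_zero.1 h2).resolve_left two_ne_zero
  induction l with
  | nil => simp at h
  | cons x l ih =>
    rw [List.map_cons, List.prod_cons, ← mul_assoc]
    by_cases hx : x = .dx μ
    · rw [hx, hsq, zero_mul]
    · have : μ ∈ l.filterMap dxIndex := by
        obtain ⟨y, hy, hy'⟩ := List.mem_filterMap.1 h
        have hyx : y = .dx μ := by
          cases y <;> simp_all [dxIndex]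
        subst hyx
        exact List.mem_filterMap.2 ⟨_, (List.mem_cons.1 hy).resolve_left (Ne.symm hx), hy'⟩
      rw [gen_mul_gen, smul_mul_assoc, mul_assoc, ih this, mul_zero, smul_zero]

theorem prod_eq_zero_of_not_nodup [CharZero K] {l : List Gen}
    (h : ¬ (l.filterMap dxIndex).Nodup) : ((l.map gen).prod : LocalForm K) = 0 := by
  induction l with
  | nil => simp at h
  | cons x l ih =>
    rw [List.map_cons, List.prod_cons]
    by_cases hl : (l.filterMap dxIndex).Nodup
    · cases x with
      | dx μ =>
        refine dx_mul_prod_eq_zero ?_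
        by_contra hμ
        exact h (by rw [List.filterMap_cons_some (f := dxIndex) (b := μ) rfl]; exact List.nodup_cons.2 ⟨hμ, hl⟩)
      | _ => exact absurd (by rwa [List.filterMap_cons_none rfl]) h
    · rw [ih hl, mul_zero]

/-- Pigeonhole: more than four differentials must repeat one. It disposes of the degrees `p > 4`,
where the Poincaré lemma is not available for the potential. -/
theorem eq_zero_of_four_lt_formDeg [CharZero K] {p k g : ℤ} (hp : 4 < p) {a : LocalForm K}
    (ha : a ∈ wspan K deg (p, k, g)) : a = 0 := by
  rw [← homogeneous_eq] at ha
  have : homogeneous K p k g = ⊥ := by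
    refine Submodule.span_eq_bot.2 ?_
    rintro _ ⟨l, rfl, hl, -⟩
    refine prod_eq_zero_of_not_nodup fun hn => ?_
    have h1 := hn.length_le_card
    have h2 : ((l.filterMap dxIndex).length : ℤ) = (l.map Gen.formDeg).sum := by
      clear hl hn h1
      induction l with
      | nil => rfl
      | cons x l ih =>
        cases x <;> simp [List.filterMap_cons, dxIndex, Gen.formDeg, ih, add_comm]
    rw [Fintype.card_fin] at h1
    omega
  rwa [this] at ha

end FormDegree

/-! ### Descent and part (2) -/

section Relative

variable {K : Type*} [Field K]

theorem proj_d (p k g : ℤ) (a : LocalForm K) :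
    proj deg (p, k, g) (d a) = d (proj deg (p - 1, k, g) a) := by
  have := proj_comm (K := K) (f := deg) (δ := (1, 0, 0)) (D := d)
    (fun w a ha => by
      simpa [d_eq_diff, Prod.add_def] using isTotalDeriv_totalDeriv.diff_mem ha) (p - 1, k, g) a
  simpa using this

theorem proj_gamma (p k g : ℤ) (a : LocalForm K) :
    proj deg (p, k, g + 1) (gamma a) = gamma (proj deg (p, k, g) a) := by
  have := proj_comm (K := K) (f := deg) (δ := (0, 0, 1)) (D := gamma)
    (fun w a ha => by simpa [Prod.add_def] using gamma_mem ha) (p, k, g) a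
  simpa using this

theorem d_mem {p k g : ℤ} {a : LocalForm K} (ha : a ∈ wspan K deg (p - 1, k, g)) :
    d a ∈ wspan K deg (p, k, g) := by
  simpa [d_eq_diff] using isTotalDeriv_totalDeriv.diff_mem ha

theorem d_d [CharZero K] (a : LocalForm K) : d (d a) = 0 := isTotalDeriv_totalDeriv.diff_diff a

/-- A `γ`-closed potential modulo `d` is trivial. -/
theorem exists_of_gamma_closed [CharZero K] {p k g : ℤ} (hp : p ≤ 4) (hk : 0 < k) {a b : LocalForm K}
    (hb : b ∈ wspan K deg (p - 1, k, g + 1)) (hγ : gamma b = 0) (hab : gamma a + d b = 0) :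
    ∃ c, gamma (a + d c) = 0 := by
  obtain ⟨β, e, hβ, hβw, hbe⟩ : ∃ β e, β ∈ ghostInvariants K ∧
      β ∈ wspan K deg (p - 1, k, g + 1) ∧ b = β + gamma e := by
    obtain ⟨β, hβ, e, rfl⟩ := exists_of_gamma_eq_zero hγ
    refine ⟨_, proj deg (p - 1, k, g) e, proj_mem_ghostInvariants (p - 1, k, g + 1) hβ,
      proj_mem _ _ _, ?_⟩
    rw [← proj_gamma, ← map_add, proj_of_mem hb]
  obtain ⟨x, hx⟩ := exists_d_eq_diff_barDeriv hβ
  have hbar : ∀ a ∈ ghostInvariants K, diff barDeriv a ∈ ghostInvariants K := fun a ha => by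
    rw [diff_apply]
    exact sum_mem fun μ _ =>
      mul_mem (inv_le_ghostInvariants (dx_mem_inv μ)) ((barDeriv_stable μ).2 a ha)
  -- `d b = -γ a` and `b = β + γ e` make `d β` exact under `γ`, hence also its ghost-invariant part.
  have hdβ : diff barDeriv β = 0 := by
    refine eq_zero_of_eq_gamma (e := d e - a - x) (hbar β hβ) ?_
    rw [map_sub, map_sub, gamma_d, eq_sub_iff_add_eq, ← hx, eq_neg_of_add_eq_zero_left hab, hbe,
      map_add]
    abel
  obtain ⟨β', hβ', -, hβe⟩ := isTotalDeriv_barDeriv.poincare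
    (S := Subalgebra.toSubmodule (ghostInvariants K))
    (fun μ a ha => Subalgebra.mul_mem _ (inv_le_ghostInvariants (dx_mem_inv μ)) ha)
    (fun μ => (barDeriv_stable μ).2) (fun μ => (iota_stable μ).2) (fun μ => (tau_stable μ).2)
    (by omega : p - 1 < 4) hk hβ hβw hdβ
  obtain ⟨y, hy⟩ := exists_d_eq_diff_barDeriv hβ'
  -- Here `b = d β' - γ (y - e)`, so `d b = -d (γ (y - e)) = γ (d (y - e))`.
  refine ⟨y - e, ?_⟩
  have hb' : b = d β' - gamma (y - e) := by
    rw [hy, ← hβe, hbe, map_sub]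
    abel
  rw [map_add, gamma_d, eq_neg_of_add_eq_zero_left hab, hb', map_sub, d_d]
  abel

theorem exists_gamma_closed_representative [CharZero K] (n : ℕ) {p k g : ℤ} (hp : p ≤ n) (hk : 0 < k)
    {a b : LocalForm K} (ha : a ∈ wspan K deg (p, k, g)) (hab : gamma a + d b = 0) :
    ∃ c ∈ wspan K deg (p - 1, k, g), gamma (a + d c) = 0 := by
  -- `b` is arbitrary, but `γ a` is homogeneous, so only one component of `b` matters.
  have hab' : gamma a + d (proj deg (p - 1, k, g + 1) b) = 0 := by
    rw [← proj_d, ← proj_of_mem (gamma_mem ha), ← map_add, hab, map_zero]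
  have hb := proj_mem deg (p - 1, k, g + 1) b
  generalize proj deg (p - 1, k, g + 1) b = b₀ at hab' hb
  induction n generalizing p g a b b₀ with
  | zero =>
    rw [eq_zero_of_formDeg_neg (by push_cast at hp; omega) hb, map_zero, add_zero] at hab'
    exact ⟨0, zero_mem _, by rwa [map_zero, add_zero]⟩
  | succ n ih =>
    by_cases hp4 : 4 < p
    · exact ⟨0, zero_mem _, by rw [eq_zero_of_four_lt_formDeg hp4 ha]; simp⟩
    have hdγ : d (gamma b₀) = 0 := by
      rw [← neg_eq_zero, ← gamma_d, eq_neg_of_add_eq_zero_right hab', map_neg, gamma_gamma, neg_zero]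
    obtain ⟨x, -, hx, hxe⟩ := isTotalDeriv_totalDeriv.poincare (S := ⊤) (fun _ _ _ => trivial)
      (fun _ _ _ => trivial) (fun _ _ _ => trivial) (fun _ _ _ => trivial) (by omega : p - 1 < 4) hk
      trivial (gamma_mem hb) hdγ
    have hx0 : gamma b₀ + d (-x) = 0 := by rw [map_neg, d_eq_diff, hxe, add_neg_cancel]
    -- The induction hypothesis is applied to `b₀`, of lower form degree and pure ghost number `g +
    -- 1`; adding `d c'` to it does not change `d b₀`.
    obtain ⟨c', hc', hγ⟩ := ih (b := -x) (by push_cast at hp; omega) hb hx0 (-x) hx0 (neg_mem hx)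
    have hab1 : gamma a + d (b₀ + d c') = 0 := by rw [map_add, d_d, add_zero, hab']
    obtain ⟨c, hc⟩ := exists_of_gamma_closed (by omega) hk (add_mem hb (d_mem hc')) hγ hab1
    refine ⟨proj deg (p - 1, k, g) c, proj_mem _ _ _, ?_⟩
    have := proj_gamma p k g (a + d c)
    rw [hc, map_zero, map_add, proj_of_mem ha, proj_d] at this
    exact this.symm

end Relative

end Gravitino

theorem mainTheorem8 (K : Type*) [Field K] [CharZero K] :
    (∀ p k : ℤ, p < 4 → 0 < k → ∀ a ∈ Gravitino.invariantPolynomials K,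
        a ∈ Gravitino.homogeneous K p k 0 → Gravitino.d a = 0 →
        ∃ b ∈ Gravitino.invariantPolynomials K,
          b ∈ Gravitino.homogeneous K (p - 1) k 0 ∧ a = Gravitino.d b) ∧
    (∀ p k g : ℤ, 0 < k → ∀ a ∈ Gravitino.homogeneous K p k g,
        ((∃ b : Gravitino.LocalForm K, Gravitino.gamma a + Gravitino.d b = 0) ↔
          ∃ c ∈ Gravitino.homogeneous K (p - 1) k g,
            Gravitino.gamma (a + Gravitino.d c) = 0)) := by
  refine ⟨fun p k hp hk a haS ha h => Gravitino.invariant_poincare hp hk haS ha h,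
    fun p k g hk a ha => ⟨?_, ?_⟩⟩
  · rintro ⟨b, hb⟩
    rw [Gravitino.homogeneous_eq] at ha ⊢
    -- Negative form degrees fall under the base case of the induction, since `p.toNat = 0` there.
    exact Gravitino.exists_gamma_closed_representative p.toNat (by omega) hk ha hb
  · rintro ⟨c, -, hc⟩
    refine ⟨-Gravitino.gamma c, ?_⟩
    rwa [map_neg, ← Gravitino.gamma_d, ← map_add]
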